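/- Let $n>r>0$ be integers and $k=n-r$. Ladder quiver. In the grid $[0,k]\times[0,r]$ call $(0,0)$, $(k,r)$ and the interior lattice points $(x,y)$, $0<x<k$, $0<y<r$, vertices; $LQ_0$ is the set of vertices. The arrow set $LQ_1$ consists of all lattice paths of positive length, with unit steps up and to the right, from a vertex $s(a)$ to a vertex $t(a)$, that pass through no other vertex. The vertical step from $(x,y)$ to $(x,y+1)$ has the label $x+y+1\in\{1,\dots,n\}$. A size-$r$ subset $I\subset\{1,\dots,n\}$ is identified with the lattice path from $(0,0)$ to $(k,r)$ whose vertical steps are in the positions $i\in I$; we write $a\in I$ if the arrow $a$ is contained in this path. Groups. Let $\tilde G=\{(\psi_a)_{a\in LQ_1}\in(\mathbb{C}^*)^{LQ_1} : \psi_a^n=1,\ \prod_a\psi_a=1\}$, and let $T\subset(\mathbb{C}^*)^{LQ_1}$ be the torus of all $(\tau_{s(a)}^{-1}\tau_{t(a)})_a$ with $\tau\in(\mathbb{C}^*)^{LQ_0}$, $\tau_{(0,0)}=1$. Put $G=\tilde G/(T\cap\tilde G)$. The group $\tilde G$ acts on the space with coordinates $p_I$ ($I$ a size-$r$ subset of $\{1,\dots,n\}$)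 by multiplying $p_I$ by $\prod_{a\in I}\psi_a$. Let $G_h\subset G$ be the subgroup of the classes of those $\psi\in\tilde G$ for which all Plücker relations $$\sum_{C=C_1\sqcup C_2}\pm\,p_{A\cup C_1}\,p_{C_2\cup B}=0\qquad(|A|+|B|=r-1,\ |C|=r+1,\ |C_1|=r-|A|)$$ are homogeneous, i.e. all monomials that occur in a relation are multiplied by the same scalar. Here the sign is that of the alternating sum over the splittings of $C$, with $p$ alternating in its indices and the elements of $A$, $C_1$, $C_2$, $B$ written in increasing order; terms with a repeated index vanish. Let $\tilde H_{n,r}=\{(\zeta_1,\dots,\zeta_n)\in(\mathbb{C}^*)^n : \zeta_i^n=1,\ (\prod_i\zeta_i)^r=1\}$, acting on $\mathrm{Gr}(n,r)=\mathrm{Mat}(r\times n)/\!/GL(r)$, i.e. on the $r$-dimensional row spaces in $\mathbb{C}^n$, by diagonal matrices on the right, and let $H_{n,r}=\tilde H_{n,r}/\{(\zeta,\dots,\zeta)\in\tilde H_{n,r}\}$. Put $\tilde\Psi(\zeta)=\big(\prod_{j\text{ a label of }a}\zeta_j\big)_{a\in LQ_1}$ for $\zeta\in\tilde H_{n,r}$.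 Theorem. (1) Every element of $T\cap\tilde G$ multiplies all coordinates $p_I$ by one common scalar, so $G$ acts on $\mathbb{P}^{\binom nr-1}$. (2) An element of $\tilde H_{n,r}$ acts trivially on $\mathrm{Gr}(n,r)$ if and only if it is of the form $(\zeta,\dots,\zeta)$, so $H_{n,r}$ is the quotient of $\tilde H_{n,r}$ that acts effectively. (3) $\tilde\Psi$ maps $\tilde H_{n,r}$ into $\tilde G$, and it induces a group isomorphism $\Psi:H_{n,r}\to G_h$, $[\zeta]\mapsto[\tilde\Psi(\zeta)]$. In particular $G_h\cong H_{n,r}$. -/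

import Mathlib

open Finset

noncomputable section

namespace Ladder

/-! ### The ladder diagram and its quiver -/

/-- The vertices of the ladder diagram on the grid with `n - r` columns and `r` rows: the bottom
left corner, the top right corner and the internal crossing points. -/
def IsVertex (n r : ℕ) (p : ℕ × ℕ) : Prop :=
  p = (0, 0) ∨ p = (n - r, r) ∨ ((0 < p.1 ∧ p.1 < n - r) ∧ (0 < p.2 ∧ p.2 < r))

/-- The set `LQ₀` of vertices of the ladder quiver. -/
def Vertex (n r : ℕ) : Type := {p : ℕ × ℕ // IsVertex n r p}

/-- The source vertex `0 ∈ LQ₀` (bottom left corner). -/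
def Vertex.zero (n r : ℕ) : Vertex n r := ⟨(0, 0), Or.inl rfl⟩

/-- The antidiagonal `x + y` on which a vertex lies. -/
def Vertex.level {n r : ℕ} (v : Vertex n r) : ℕ := v.1.1 + v.1.2

/-- The vertical unit step from `(x, y)` to `(x, y + 1)` carries the label `x + y + 1`; counted
from `0` this is the element `x + y` of `Fin n`.  A path with steps up and to the right is recorded
by its starting point `p` and the set `L` of labels of its vertical steps: the step that
leaves the antidiagonal `x + y = i` is vertical if `i ∈ L` and horizontal otherwise.
`pathPoint p L t` is the point of this path on the antidiagonal `x + y = t`. -/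
def pathPoint {n : ℕ} (p : ℕ × ℕ) (L : Finset (Fin n)) (t : ℕ) : ℕ × ℕ :=
  (p.1 + #{i : Fin n | p.1 + p.2 ≤ i.1 ∧ i.1 < t ∧ i ∉ L},
   p.2 + #{i : Fin n | p.1 + p.2 ≤ i.1 ∧ i.1 < t ∧ i ∈ L})

/-- The arrows `LQ₁` of the ladder quiver: the paths, going up and to the right, from a vertex
`src` to another vertex `tgt` which do not pass through any other vertex.  `labels` is the set of
labels of the vertical steps of the arrow. -/
@[ext] structure Arrow (n r : ℕ) where
  src : Vertex n r
  tgt : Vertex n r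
  labels : Finset (Fin n)
  lt : src.level < tgt.level
  mem_labels : ∀ i ∈ labels, src.level ≤ i.1 ∧ i.1 < tgt.level
  ends : pathPoint src.1 labels tgt.level = tgt.1
  between : ∀ t, src.level < t → t < tgt.level → ¬ IsVertex n r (pathPoint src.1 labels t)

instance (n r : ℕ) : Finite (Vertex n r) := by
  have : ({p : ℕ × ℕ | IsVertex n r p}).Finite := by
    refine (Set.finite_Iic ((n - r, r) : ℕ × ℕ)).subset ?_
    rintro ⟨x, y⟩ h
    simp only [Set.mem_ofPred_eq, IsVertex, Prod.mk.injEq] at h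
    simp only [Set.mem_Iic, Prod.mk_le_mk]
    omega
  exact this.to_subtype

instance (n r : ℕ) : Finite (Arrow n r) :=
  Finite.of_injective (fun a : Arrow n r => (a.src, a.tgt, a.labels)) (by
    intro a b h
    simp only [Prod.mk.injEq] at h
    exact Arrow.ext h.1 h.2.1 h.2.2)

instance (n r : ℕ) : Fintype (Arrow n r) := Fintype.ofFinite _

/-- The index set of the Plücker coordinates: the subsets of size `r` of an `n`-element set.
Such a subset `I` is the set of positions of the vertical steps of a path in the
ladder diagram from the bottom left to the top right corner, equivalently of a partition in an
`r × (n - r)` box. -/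
def Index (n r : ℕ) : Type := {I : Finset (Fin n) // #I = r}

/-- The arrow `a` is contained in the path from `(0, 0)` with vertical steps `I`: the path goes
through the source of `a`, and from there it makes the same steps as `a` until the target of `a`. -/
def Arrow.InPath {n r : ℕ} (a : Arrow n r) (I : Finset (Fin n)) : Prop :=
  pathPoint (0, 0) I a.src.level = a.src.1 ∧
    ∀ i : Fin n, a.src.level ≤ i.1 → i.1 < a.tgt.level → (i ∈ I ↔ i ∈ a.labels)

/-! ### The groups -/

/-- `G̃ = {(ψ_a) : ψ_a ^ n = 1, ∏ ψ_a = 1}`. -/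
def GTilde (n r : ℕ) : Subgroup (Arrow n r → ℂˣ) where
  carrier := {ψ | (∀ a, ψ a ^ n = 1) ∧ ∏ a, ψ a = 1}
  mul_mem' := by
    rintro ψ φ ⟨h1, h2⟩ ⟨h3, h4⟩
    refine ⟨fun a => ?_, ?_⟩
    · simp [mul_pow, h1, h3]
    · simp [Finset.prod_mul_distrib, h2, h4]
  one_mem' := by simp
  inv_mem' := by
    rintro ψ ⟨h1, h2⟩
    refine ⟨fun a => ?_, ?_⟩
    · simp [h1]
    · simp [h2]

/-- The torus `T = (ℂ*)^(LQ₀ ∖ {0})` as a group of diagonal matrices: it acts on the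
coordinate `y_a` with weight `-e_{s(a)} + e_{t(a)}`, where `e_0 = 0`. -/
def Torus (n r : ℕ) : Subgroup (Arrow n r → ℂˣ) where
  carrier := {ψ | ∃ τ : Vertex n r → ℂˣ, τ (Vertex.zero n r) = 1 ∧
    ∀ a, ψ a = (τ a.src)⁻¹ * τ a.tgt}
  mul_mem' := by
    rintro ψ φ ⟨τ, h1, h2⟩ ⟨σ, h3, h4⟩
    refine ⟨τ * σ, by simp [h1, h3], fun a => ?_⟩
    simp only [Pi.mul_apply, h2, h4, mul_inv]
    exact mul_mul_mul_comm _ _ _ _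
  one_mem' := ⟨1, by simp, by simp⟩
  inv_mem' := by
    rintro ψ ⟨τ, h1, h2⟩
    exact ⟨τ⁻¹, by simp [h1], fun a => by simp [h2, mul_comm]⟩

/-- `G = G̃ / (T ∩ G̃)`. -/
abbrev G (n r : ℕ) : Type := GTilde n r ⧸ (Torus n r).subgroupOf (GTilde n r)

/-- `H̃_{n,r} = {(ζ_1, …, ζ_n) : ζ_i ^ n = 1, (∏ ζ_i) ^ r = 1}`. -/
def HTilde (n r : ℕ) : Subgroup (Fin n → ℂˣ) where
  carrier := {ζ | (∀ i, ζ i ^ n = 1) ∧ (∏ i, ζ i) ^ r = 1}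
  mul_mem' := by
    rintro ψ φ ⟨h1, h2⟩ ⟨h3, h4⟩
    refine ⟨fun a => ?_, ?_⟩
    · simp [mul_pow, h1, h3]
    · simp [Finset.prod_mul_distrib, mul_pow, h2, h4]
  one_mem' := by simp
  inv_mem' := by
    rintro ψ ⟨h1, h2⟩
    refine ⟨fun a => ?_, ?_⟩
    · simp [h1]
    · simp [h2]

/-- The subgroup of the elements `(ζ, …, ζ)` of `H̃_{n,r}`. -/
def HScalar (n r : ℕ) : Subgroup (HTilde n r) where
  carrier := {h | ∃ c : ℂˣ, ∀ i, h.1 i = c}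
  mul_mem' := by
    rintro h k ⟨c, hc⟩ ⟨d, hd⟩
    exact ⟨c * d, fun i => by simp [hc, hd]⟩
  one_mem' := ⟨1, by simp⟩
  inv_mem' := by
    rintro h ⟨c, hc⟩
    exact ⟨c⁻¹, fun i => by simp [hc]⟩

/-- `H_{n,r} = H̃_{n,r} / {(ζ, …, ζ) ∈ H̃_{n,r}}`. -/
abbrev H (n r : ℕ) : Type := HTilde n r ⧸ HScalar n r

/-- The invertible diagonal map of `ℂⁿ` (row vectors) given by `ζ`. -/
def diagMap {n : ℕ} (ζ : Fin n → ℂˣ) : (Fin n → ℂ) →ₗ[ℂ] (Fin n → ℂ) :=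
  LinearMap.pi fun i => (ζ i : ℂ) • LinearMap.proj i

/-- `ζ` fixes every point of `Gr(n,r)`.  A point of `Mat(r × n) // GL(r)` is an `r`-dimensional
row space in `ℂⁿ`, and `ζ` acts by multiplication with a diagonal matrix on the right. -/
def ActsTriviallyOnGr (n r : ℕ) (ζ : Fin n → ℂˣ) : Prop :=
  ∀ W : Submodule ℂ (Fin n → ℂ), Module.finrank ℂ W = r → W.map (diagMap ζ) = W

/-- `Ψ̃(ζ)_a` is the product of the `ζ_j` over the labels `j` of the arrow `a`. -/
def PsiTilde (n r : ℕ) (ζ : Fin n → ℂˣ) : Arrow n r → ℂˣ := fun a => ∏ j ∈ a.labels, ζ j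

/-! ### Plücker relations and homogeneity -/

open Classical in
/-- The weight with which `ψ` acts on the Plücker coordinate `p_I`: the product of the `ψ_a`
over the arrows `a` of the path `I`. -/
def weight {n r : ℕ} (ψ : Arrow n r → ℂˣ) (I : Index n r) : ℂˣ :=
  ∏ a : Arrow n r with a.InPath I.1, ψ a

/-- The weight of a monomial in the Plücker coordinates. -/
def monomialWeight {n r : ℕ} (ψ : Arrow n r → ℂˣ) (m : Index n r →₀ ℕ) : ℂˣ :=
  m.prod fun I e => weight ψ I ^ e

/-- The polynomial `R` is homogeneous for the action of `ψ`: all its monomials have the same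
weight. -/
def IsHomogeneousFor {n r : ℕ} (ψ : Arrow n r → ℂˣ) (R : MvPolynomial (Index n r) ℂ) : Prop :=
  ∀ m ∈ R.support, ∀ m' ∈ R.support, monomialWeight ψ m = monomialWeight ψ m'

/-- The Plücker coordinate of a set of size `r` (and `0` for sets of another size). -/
def coord {n : ℕ} (r : ℕ) (S : Finset (Fin n)) : MvPolynomial (Index n r) ℂ :=
  if h : #S = r then MvPolynomial.X ⟨S, h⟩ else 0

/-- The number of inversions between `A` and `B`; `(-1) ^ inv A B` is the sign of the permutation
that sorts the word `A B` (for disjoint `A`, `B`, each written in increasing order). -/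
def inv {n : ℕ} (A B : Finset (Fin n)) : ℕ := #{x ∈ A ×ˢ B | x.2 < x.1}

/-- The Plücker relation with fixed parts `A`, `B`, where `#A + #B = r - 1`, and alternating part
`C` with `#C = r + 1`: the signed sum of `p_{A ∪ C₁} p_{(C ∖ C₁) ∪ B}` over all subsets
`C₁` of `C` of size `r - #A`.  Terms in which an index is repeated vanish. -/
def pluckerRelation {n : ℕ} (r : ℕ) (A B C : Finset (Fin n)) : MvPolynomial (Index n r) ℂ :=
  ∑ C₁ ∈ C.powersetCard (r - #A),
    (-1) ^ (inv A C₁ + inv C₁ (C \ C₁) + inv (C \ C₁) B) *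
      (coord r (A ∪ C₁) * coord r ((C \ C₁) ∪ B))

/-- All Plücker relations are homogeneous for the action of `ψ`. -/
def PreservesPlucker {n r : ℕ} (ψ : Arrow n r → ℂˣ) : Prop :=
  ∀ A B C : Finset (Fin n), #A + #B + 1 = r → #C = r + 1 →
    IsHomogeneousFor ψ (pluckerRelation r A B C)

theorem weight_mul {n r : ℕ} (ψ φ : Arrow n r → ℂˣ) (I : Index n r) :
    weight (ψ * φ) I = weight ψ I * weight φ I := by
  simp [weight, Finset.prod_mul_distrib]

theorem weight_one {n r : ℕ} (I : Index n r) : weight (1 : Arrow n r → ℂˣ) I = 1 := by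
  simp [weight]

theorem weight_inv {n r : ℕ} (ψ : Arrow n r → ℂˣ) (I : Index n r) :
    weight ψ⁻¹ I = (weight ψ I)⁻¹ := by
  simp [weight]

theorem PreservesPlucker.one {n r : ℕ} : PreservesPlucker (1 : Arrow n r → ℂˣ) := by
  intro A B C _ _ m _ m' _
  simp [monomialWeight, weight_one]

theorem PreservesPlucker.mul {n r : ℕ} {ψ φ : Arrow n r → ℂˣ} (h : PreservesPlucker ψ)
    (k : PreservesPlucker φ) : PreservesPlucker (ψ * φ) := by
  intro A B C hA hC m hm m' hm'
  have e : ∀ q : Index n r →₀ ℕ,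
      monomialWeight (ψ * φ) q = monomialWeight ψ q * monomialWeight φ q := by
    intro q
    simp [monomialWeight, weight_mul, mul_pow, Finsupp.prod_mul]
  rw [e, e, h A B C hA hC m hm m' hm', k A B C hA hC m hm m' hm']

theorem PreservesPlucker.inv {n r : ℕ} {ψ : Arrow n r → ℂˣ} (h : PreservesPlucker ψ) :
    PreservesPlucker ψ⁻¹ := by
  intro A B C hA hC m hm m' hm'
  have e : ∀ q : Index n r →₀ ℕ, monomialWeight ψ⁻¹ q = (monomialWeight ψ q)⁻¹ := by
    intro q
    simp [monomialWeight, weight_inv, Finsupp.prod_inv]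
  rw [e, e, h A B C hA hC m hm m' hm']

/-- `G_h`: the subgroup of the classes in `G` of the elements of `G̃` for whose action all Plücker
relations are homogeneous.  As `T ∩ G̃` acts by scaling on the Plücker coordinates and each
Plücker relation is a quadric, it does not matter which representative in `G̃` is used. -/
def Gh (n r : ℕ) : Subgroup (G n r) where
  carrier := {x | ∃ g : GTilde n r, PreservesPlucker g.1 ∧ QuotientGroup.mk g = x}
  mul_mem' := by
    rintro _ _ ⟨g, hg, rfl⟩ ⟨k, hk, rfl⟩
    exact ⟨g * k, hg.mul hk, rfl⟩
  one_mem' := ⟨1, PreservesPlucker.one, rfl⟩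
  inv_mem' := by
    rintro _ ⟨g, hg, rfl⟩
    exact ⟨g⁻¹, hg.inv, rfl⟩

end Ladder

end

noncomputable section

namespace Ladder

variable {n r : ℕ}

/-! Everything is read off the weights of the coordinates `p_I`. The arrows of a path subdivide its
steps, so `Ψ̃(ζ)` has weight `∏_{i ∈ I} ζ_i` (`weight_psiTilde`), while a torus element telescopes
to a constant weight (`weight_torus`). Conversely, constant weight forces membership in the torus
(`mem_torus_of_weight_const`): `τ_v` is the partial weight of any path up to `v`, and splicing two
paths at `v` shows that the choice does not matter. Hence a class in `G` is determined by its
weights up to a common scalar.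

Multiplicative weights make all Plücker relations homogeneous. Conversely, the relations with `B =
∅` yield an exchange rule (`PreservesPlucker.exchange`), which forces the weights into the form `c
∏_{i ∈ I} ζ_i` (`exists_of_exchange`). This gives surjectivity of `Ψ`; its kernel consists of the
constant `ζ`, because constant weight means that exchanging one element of `I` has no effect.

The conditions `∏ ψ_a = 1` and `(∏ ζ_i)^r = 1` are matched by the `n` cyclic intervals of length
`r`. Their paths run along the boundary except for crossing the grid on one vertical line, or on one
horizontal line at height `0 < y < r`. Every arrow lies on exactly one of these paths and every
label lies in exactly `r` of the intervals, so `∏ ψ_a` is the product of the `n` cyclic weights, and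
for `Ψ̃(ζ)` this is `(∏ ζ_i)^r`. -/

/-! ### Points of lattice paths -/

theorem pathPoint_base (p : ℕ × ℕ) (L : Finset (Fin n)) : pathPoint p L (p.1 + p.2) = p := by
  have h : ∀ q : Fin n → Prop, ∀ [DecidablePred q],
      #{i : Fin n | p.1 + p.2 ≤ i.1 ∧ i.1 < p.1 + p.2 ∧ q i} = 0 := by
    intro q _
    rw [Finset.card_eq_zero, Finset.filter_eq_empty_iff]
    intro i _ hi
    omega
  simp [pathPoint, h]

theorem pathPoint_mono (p : ℕ × ℕ) (L : Finset (Fin n)) {t u : ℕ} (h : t ≤ u) :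
    pathPoint p L t ≤ pathPoint p L u := by
  refine Prod.mk_le_mk.2 ⟨?_, ?_⟩ <;>
  · refine Nat.add_le_add_left (Finset.card_le_card fun i => ?_) _
    simp only [Finset.mem_filter, Finset.mem_univ, true_and]
    rintro ⟨h1, h2, h3⟩
    exact ⟨h1, by omega, h3⟩

theorem card_filter_lt_succ (s t : ℕ) (ht : t < n) (hs : s ≤ t) (q : Fin n → Prop)
    [DecidablePred q] :
    #{i : Fin n | s ≤ i.1 ∧ i.1 < t + 1 ∧ q i} =
      #{i : Fin n | s ≤ i.1 ∧ i.1 < t ∧ q i} + if q ⟨t, ht⟩ then 1 else 0 := by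
  split_ifs with h
  · rw [← Finset.card_insert_of_notMem (a := ⟨t, ht⟩) (by simp)]
    congr 1
    ext i
    simp only [Finset.mem_filter, Finset.mem_univ, true_and, Finset.mem_insert, Fin.ext_iff]
    constructor
    · rintro ⟨h1, h2, h3⟩
      by_cases e : i.1 = t
      · exact Or.inl e
      · exact Or.inr ⟨h1, by omega, h3⟩
    · rintro (e | ⟨h1, h2, h3⟩)
      · obtain rfl : i = ⟨t, ht⟩ := Fin.ext e
        exact ⟨hs, by simp, h⟩
      · exact ⟨h1, by omega, h3⟩
  · rw [add_zero]
    congr 1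
    ext i
    simp only [Finset.mem_filter, Finset.mem_univ, true_and]
    constructor
    · rintro ⟨h1, h2, h3⟩
      refine ⟨h1, ?_, h3⟩
      by_contra e
      obtain rfl : i = ⟨t, ht⟩ := Fin.ext (by simp only; omega)
      exact h h3
    · rintro ⟨h1, h2, h3⟩
      exact ⟨h1, by omega, h3⟩

theorem pathPoint_succ_of_mem {p : ℕ × ℕ} {L : Finset (Fin n)} {t : ℕ} (ht : t < n)
    (hp : p.1 + p.2 ≤ t) (h : (⟨t, ht⟩ : Fin n) ∈ L) :
    pathPoint p L (t + 1) = ((pathPoint p L t).1, (pathPoint p L t).2 + 1) := by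
  simp only [pathPoint]
  rw [card_filter_lt_succ _ _ ht hp, card_filter_lt_succ _ _ ht hp]
  simp [h, add_assoc]

theorem pathPoint_succ_of_notMem {p : ℕ × ℕ} {L : Finset (Fin n)} {t : ℕ} (ht : t < n)
    (hp : p.1 + p.2 ≤ t) (h : (⟨t, ht⟩ : Fin n) ∉ L) :
    pathPoint p L (t + 1) = ((pathPoint p L t).1 + 1, (pathPoint p L t).2) := by
  simp only [pathPoint]
  rw [card_filter_lt_succ _ _ ht hp, card_filter_lt_succ _ _ ht hp]
  simp [h, add_assoc]

theorem pathPoint_sum {p : ℕ × ℕ} (L : Finset (Fin n)) {t : ℕ} (hp : p.1 + p.2 ≤ t)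
    (ht : t ≤ n) : (pathPoint p L t).1 + (pathPoint p L t).2 = t := by
  induction t, hp using Nat.le_induction with
  | base => rw [pathPoint_base]
  | succ t hp ih =>
    by_cases h : (⟨t, ht⟩ : Fin n) ∈ L
    · rw [pathPoint_succ_of_mem ht hp h]
      have := ih (by omega)
      simp only
      omega
    · rw [pathPoint_succ_of_notMem ht hp h]
      have := ih (by omega)
      simp only
      omega

theorem pathPoint_zero (L : Finset (Fin n)) : pathPoint (0, 0) L 0 = (0, 0) :=
  pathPoint_base (0, 0) L

theorem pathPoint_end (L : Finset (Fin n)) : pathPoint (0, 0) L n = (n - #L, #L) := by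
  have h := pathPoint_sum (p := (0, 0)) L (Nat.zero_le n) le_rfl
  have h2 : (pathPoint (0, 0) L n).2 = #L := by
    simp [pathPoint]
  ext
  · simp only
    omega
  · exact h2

/-- Membership of a label can be read off the points of a path. -/
theorem mem_iff_pathPoint {p : ℕ × ℕ} {L : Finset (Fin n)} {t : ℕ} (ht : t < n)
    (hp : p.1 + p.2 ≤ t) :
    (⟨t, ht⟩ : Fin n) ∈ L ↔ (pathPoint p L (t + 1)).2 = (pathPoint p L t).2 + 1 := by
  by_cases h : (⟨t, ht⟩ : Fin n) ∈ L
  · simp [h, pathPoint_succ_of_mem ht hp h]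
  · simp [h, pathPoint_succ_of_notMem ht hp h]

/-- Two paths that meet and make the same steps from there on coincide from there on. -/
theorem pathPoint_congr {p q : ℕ × ℕ} {L M : Finset (Fin n)} {s u : ℕ} (hu : u ≤ n)
    (hp : p.1 + p.2 ≤ s) (hq : q.1 + q.2 ≤ s) (h : pathPoint p L s = pathPoint q M s)
    (hLM : ∀ i : Fin n, s ≤ i.1 → i.1 < u → (i ∈ L ↔ i ∈ M)) {t : ℕ} (hst : s ≤ t)
    (htu : t ≤ u) : pathPoint p L t = pathPoint q M t := by
  induction t, hst using Nat.le_induction with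
  | base => exact h
  | succ t hst ih =>
    have htn : t < n := by omega
    have e := ih (by omega)
    by_cases hL : (⟨t, htn⟩ : Fin n) ∈ L
    · rw [pathPoint_succ_of_mem htn (by omega) hL,
        pathPoint_succ_of_mem htn (by omega) ((hLM ⟨t, htn⟩ hst htu).1 hL), e]
    · rw [pathPoint_succ_of_notMem htn (by omega) hL,
        pathPoint_succ_of_notMem htn (by omega) (fun h' => hL ((hLM ⟨t, htn⟩ hst htu).2 h')), e]

/-! ### Arrows in paths -/

theorem IsVertex.le {p : ℕ × ℕ} (h : IsVertex n r p) : p.1 ≤ n - r ∧ p.2 ≤ r := by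
  rcases h with rfl | rfl | h
  · simp
  · simp
  · omega

theorem Vertex.level_le (hrn : r ≤ n) (v : Vertex n r) : v.level ≤ n := by
  have := v.2.le
  unfold Vertex.level
  omega

theorem Vertex.level_zero : (Vertex.zero n r).level = 0 := rfl

theorem Arrow.InPath.pathPoint_eq (hrn : r ≤ n) {a : Arrow n r} {I : Finset (Fin n)}
    (h : a.InPath I) {t : ℕ} (h1 : a.src.level ≤ t) (h2 : t ≤ a.tgt.level) :
    pathPoint (0, 0) I t = pathPoint a.src.1 a.labels t := by
  exact pathPoint_congr (a.tgt.level_le hrn) (Nat.zero_le _) le_rfl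
    (h.1.trans (pathPoint_base _ _).symm) h.2 h1 h2

theorem Arrow.InPath.pathPoint_tgt (hrn : r ≤ n) {a : Arrow n r} {I : Finset (Fin n)}
    (h : a.InPath I) : pathPoint (0, 0) I a.tgt.level = a.tgt.1 := by
  rw [h.pathPoint_eq hrn a.lt.le le_rfl, a.ends]

theorem Arrow.inPath_of_pathPoint_eq {a : Arrow n r} {I : Finset (Fin n)}
    (h : ∀ t, a.src.level ≤ t → t ≤ a.tgt.level →
      pathPoint (0, 0) I t = pathPoint a.src.1 a.labels t) : a.InPath I := by
  refine ⟨?_, fun i h1 h2 => ?_⟩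
  · rw [h _ le_rfl a.lt.le]
    exact pathPoint_base _ _
  · rw [show i = ⟨i.1, i.2⟩ from rfl, mem_iff_pathPoint (p := (0, 0)) i.2 (Nat.zero_le _),
      mem_iff_pathPoint (p := a.src.1) i.2 h1, h _ h1 h2.le, h _ (by omega) h2]

/-- A vertex on a path lies either before or behind a given arrow of the path. -/
theorem Arrow.InPath.level_le_or (hrn : r ≤ n) {a : Arrow n r} {I : Finset (Fin n)}
    (h : a.InPath I) {t : ℕ} (ht : IsVertex n r (pathPoint (0, 0) I t)) :
    t ≤ a.src.level ∨ a.tgt.level ≤ t := by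
  by_contra! hc
  rw [h.pathPoint_eq hrn hc.1.le hc.2.le] at ht
  exact a.between t hc.1 hc.2 ht

theorem Arrow.InPath.isVertex_src {a : Arrow n r} {I : Finset (Fin n)}
    (h : a.InPath I) : IsVertex n r (pathPoint (0, 0) I a.src.level) := h.1 ▸ a.src.2

theorem Arrow.InPath.isVertex_tgt (hrn : r ≤ n) {a : Arrow n r} {I : Finset (Fin n)}
    (h : a.InPath I) : IsVertex n r (pathPoint (0, 0) I a.tgt.level) :=
  h.pathPoint_tgt hrn ▸ a.tgt.2

theorem Arrow.InPath.labels_eq {a : Arrow n r} {I : Finset (Fin n)} (h : a.InPath I) :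
    a.labels = {i ∈ I | a.src.level ≤ i.1 ∧ i.1 < a.tgt.level} := by
  ext i
  rw [Finset.mem_filter]
  constructor
  · intro hi
    have := a.mem_labels i hi
    exact ⟨(h.2 i this.1 this.2).2 hi, this⟩
  · rintro ⟨hi, h1, h2⟩
    exact (h.2 i h1 h2).1 hi

/-- The ends of each arrow are vertices of the path, so they cannot lie strictly inside the other
arrow. Sharing a step therefore forces equal ends, and the path determines the labels in between. -/
theorem Arrow.InPath.eq (hrn : r ≤ n) {a b : Arrow n r} {I : Finset (Fin n)} (ha : a.InPath I)
    (hb : b.InPath I) {t : ℕ} (ha1 : a.src.level ≤ t) (ha2 : t < a.tgt.level)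
    (hb1 : b.src.level ≤ t) (hb2 : t < b.tgt.level) : a = b := by
  have h1 := ha.level_le_or hrn hb.isVertex_src
  have h2 := hb.level_le_or hrn ha.isVertex_src
  have h3 := ha.level_le_or hrn (hb.isVertex_tgt hrn)
  have h4 := hb.level_le_or hrn (ha.isVertex_tgt hrn)
  have hs : a.src.level = b.src.level := by omega
  have ht : a.tgt.level = b.tgt.level := by omega
  refine Arrow.ext (Subtype.ext ?_) (Subtype.ext ?_) ?_
  · rw [← ha.1, ← hb.1, hs]
  · rw [← ha.pathPoint_tgt hrn, ← hb.pathPoint_tgt hrn, ht]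
  · rw [ha.labels_eq, hb.labels_eq, hs, ht]

theorem isVertex_pathPoint_zero (I : Finset (Fin n)) :
    IsVertex n r (pathPoint (0, 0) I 0) := by
  rw [pathPoint_zero]
  exact Or.inl rfl

theorem isVertex_pathPoint_end (I : Index n r) : IsVertex n r (pathPoint (0, 0) I.1 n) := by
  rw [pathPoint_end, I.2]
  exact Or.inr (Or.inl rfl)

/-- Every step of a path belongs to an arrow of the path. -/
theorem exists_inPath (I : Index n r) {t : ℕ} (ht : t < n) :
    ∃ a : Arrow n r, a.InPath I.1 ∧ a.src.level ≤ t ∧ t < a.tgt.level := by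
  classical
  let P : ℕ → Prop := fun l => IsVertex n r (pathPoint (0, 0) I.1 l)
  -- The arrow runs from the last vertex at or below level `t` to the first vertex above it.
  let s := Nat.findGreatest P t
  have hs : P s := Nat.findGreatest_spec (Nat.zero_le t) (isVertex_pathPoint_zero I.1)
  have hst : s ≤ t := Nat.findGreatest_le t
  have hex : ∃ l, t < l ∧ P l := ⟨n, ht, isVertex_pathPoint_end I⟩
  let u := Nat.find hex
  obtain ⟨htu, hu⟩ : t < u ∧ P u := Nat.find_spec hex
  have hun : u ≤ n := Nat.find_min' hex ⟨ht, isVertex_pathPoint_end I⟩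
  have hs0 := pathPoint_sum (p := (0, 0)) I.1 (Nat.zero_le s) (by omega)
  have hu0 := pathPoint_sum (p := (0, 0)) I.1 (Nat.zero_le u) hun
  have key : ∀ l, s ≤ l → l ≤ u → pathPoint (pathPoint (0, 0) I.1 s)
      {i ∈ I.1 | s ≤ i.1 ∧ i.1 < u} l = pathPoint (0, 0) I.1 l := by
    intro l h1 h2
    refine pathPoint_congr hun hs0.le (Nat.zero_le _) ?_ ?_ h1 h2
    · exact (congrArg _ hs0.symm).trans (pathPoint_base _ _)
    · intro i h1 h2
      simp [h1, h2]
  refine ⟨⟨⟨_, hs⟩, ⟨_, hu⟩, {i ∈ I.1 | s ≤ i.1 ∧ i.1 < u}, ?_, ?_, ?_, ?_⟩, ⟨?_, ?_⟩, ?_, ?_⟩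
  · simp only [Vertex.level, hs0, hu0]; omega
  · intro i hi
    simp only [Vertex.level, hs0, hu0]
    exact (Finset.mem_filter.1 hi).2
  · simp only [Vertex.level, hu0]
    exact key u (by omega) le_rfl
  · intro l h1 h2
    simp only [Vertex.level, hs0, hu0] at h1 h2
    simp only
    rw [key l h1.le h2.le]
    intro hl
    by_cases hlt : l ≤ t
    · exact Nat.findGreatest_is_greatest h1 hlt hl
    · exact Nat.find_min hex h2 ⟨by omega, hl⟩
  · simp only [Vertex.level, hs0]
  · intro i h1 h2
    simp only [Vertex.level, hs0, hu0] at h1 h2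
    simp [h1, h2]
  · simpa only [Vertex.level, hs0] using hst
  · simpa only [Vertex.level, hu0] using htu

/-! ### Weights of `Ψ̃(ζ)` and of torus elements -/

open Classical in
/-- The arrows of a path subdivide its steps. -/
theorem prod_inPath_prod_Ico {M : Type*} [CommMonoid M] (hrn : r ≤ n) (I : Index n r)
    (g : ℕ → M) :
    ∏ a : Arrow n r with a.InPath I.1, ∏ t ∈ Ico a.src.level a.tgt.level, g t =
      ∏ t ∈ range n, g t := by
  rw [← Finset.prod_biUnion]
  · refine Finset.prod_congr ?_ fun _ _ => rfl
    ext t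
    simp only [Finset.mem_biUnion, Finset.mem_filter, Finset.mem_univ, true_and, Finset.mem_Ico,
      Finset.mem_range]
    constructor
    · rintro ⟨a, -, -, h⟩
      exact h.trans_le (a.tgt.level_le hrn)
    · exact exists_inPath I
  · intro a ha b hb hab
    simp only [Finset.coe_filter, Finset.mem_univ, true_and, Set.mem_ofPred_eq] at ha hb
    refine Finset.disjoint_left.2 fun t h1 h2 => hab ?_
    rw [Finset.mem_Ico] at h1 h2
    exact ha.eq hrn hb h1.1 h1.2 h2.1 h2.2

/-- Rewrites a product over labels as one over levels, horizontal steps contributing `1`, which is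
the shape that `prod_inPath_prod_Ico` needs. -/
theorem prod_filter_Ico_eq {M : Type*} [CommMonoid M] (ζ : Fin n → M) (I : Finset (Fin n))
    (s u : ℕ) :
    ∏ i ∈ I with s ≤ i.1 ∧ i.1 < u, ζ i =
      ∏ t ∈ Ico s u, if h : ∃ h : t < n, (⟨t, h⟩ : Fin n) ∈ I then ζ ⟨t, h.1⟩ else 1 := by
  refine Finset.prod_of_injOn (fun i : Fin n => i.1) (Fin.val_injective.injOn) ?_ ?_ ?_
  · intro i hi
    simpa using (Finset.mem_filter.1 hi).2
  · intro t ht hi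
    rw [dif_neg]
    rintro ⟨h, h'⟩
    exact hi ⟨⟨t, h⟩, by simpa [h'] using ht, rfl⟩
  · intro i hi
    rw [dif_pos ⟨i.2, (Finset.mem_filter.1 hi).1⟩]

theorem weight_psiTilde (hrn : r ≤ n) (ζ : Fin n → ℂˣ) (I : Index n r) :
    weight (PsiTilde n r ζ) I = ∏ i ∈ I.1, ζ i := by
  classical
  have h1 : ∏ i ∈ I.1, ζ i = ∏ i ∈ I.1 with 0 ≤ i.1 ∧ i.1 < n, ζ i := by
    rw [Finset.filter_true_of_mem (fun i _ => ⟨Nat.zero_le _, i.2⟩)]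
  rw [h1, prod_filter_Ico_eq, ← Finset.range_eq_Ico, ← prod_inPath_prod_Ico hrn I,
    weight]
  refine Finset.prod_congr (by congr) fun a ha => ?_
  rw [← prod_filter_Ico_eq, PsiTilde,
    ((Finset.mem_filter.1 ha).2).labels_eq]

/-- Elements of the torus scale all Plücker coordinates by the same factor. -/
theorem weight_torus (hrn : r ≤ n) (τ : Vertex n r → ℂˣ) (hτ : τ (Vertex.zero n r) = 1)
    {ψ : Arrow n r → ℂˣ} (hψ : ∀ a, ψ a = (τ a.src)⁻¹ * τ a.tgt) (I : Index n r) :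
    weight ψ I = τ ⟨(n - r, r), Or.inr (Or.inl rfl)⟩ := by
  classical
  -- The value `1` away from vertices is immaterial: each arrow's product of `(F t)⁻¹ * F (t + 1)`
  -- telescopes to its two ends.
  let F : ℕ → ℂˣ := fun t =>
    if h : IsVertex n r (pathPoint (0, 0) I.1 t) then τ ⟨_, h⟩ else 1
  have hF : ∀ (v : Vertex n r) (t : ℕ), pathPoint (0, 0) I.1 t = v.1 → F t = τ v := by
    intro v t h
    have h' : IsVertex n r (pathPoint (0, 0) I.1 t) := h ▸ v.2
    simp only [F, dif_pos h']
    congr 1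
    exact Subtype.ext h
  have hn := hF ⟨(n - r, r), Or.inr (Or.inl rfl)⟩ n (by rw [pathPoint_end, I.2])
  have h0 := hF (Vertex.zero n r) 0 (pathPoint_zero _)
  have key := prod_inPath_prod_Ico hrn I (fun t => (F t)⁻¹ * F (t + 1))
  have tel : ∀ m, ∏ t ∈ range m, ((F t)⁻¹ * F (t + 1)) = (F 0)⁻¹ * F m := by
    intro m
    induction m with
    | zero => simp
    | succ m ih => rw [Finset.prod_range_succ, ih, mul_assoc, mul_inv_cancel_left]
  rw [tel, h0, hτ, inv_one, one_mul, hn] at key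
  rw [← key, weight]
  refine Finset.prod_congr (by congr) fun a ha => ?_
  have ha := (Finset.mem_filter.1 ha).2
  have := Finset.prod_range_mul_prod_Ico (fun t => (F t)⁻¹ * F (t + 1)) a.lt.le
  rw [tel, tel] at this
  rw [hψ, ← hF _ _ ha.1, ← hF _ _ (ha.pathPoint_tgt hrn)]
  rw [mul_assoc, mul_left_cancel_iff] at this
  rw [← this, inv_mul_cancel_left]

/-! ### Cyclic intervals -/

/-- The cyclic interval of length `r` that starts at `c`. -/
def cyclicInterval (n r c : ℕ) : Finset (Fin n) :=
  {i : Fin n | (c ≤ i.1 ∧ i.1 < c + r) ∨ i.1 + n < c + r}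

theorem mem_cyclicInterval {c : ℕ} {i : Fin n} :
    i ∈ cyclicInterval n r c ↔ (c ≤ i.1 ∧ i.1 < c + r) ∨ i.1 + n < c + r := by
  simp [cyclicInterval]

/-- The first summand counts the wrapped part `[0, c + r - n)`, the second the part that starts at
`c`; truncated subtraction makes an absent part contribute `0`. -/
theorem pathPoint_cyclicInterval (hrn : r ≤ n) {c t : ℕ} (ht : t ≤ n) :
    (pathPoint (0, 0) (cyclicInterval n r c) t).2 = min t (c + r - n) + min (t - c) r := by
  induction t with
  | zero => simp [pathPoint_zero]
  | succ t ih =>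
    have ih := ih (by omega)
    by_cases h : (⟨t, ht⟩ : Fin n) ∈ cyclicInterval n r c
    · rw [pathPoint_succ_of_mem (p := (0, 0)) ht (Nat.zero_le _) h, ih]
      rw [mem_cyclicInterval] at h
      simp only at h ⊢
      omega
    · rw [pathPoint_succ_of_notMem (p := (0, 0)) ht (Nat.zero_le _) h, ih]
      rw [mem_cyclicInterval] at h
      simp only at h ⊢
      omega

theorem card_cyclicInterval (hrn : r ≤ n) {c : ℕ} (hc : c < n) :
    #(cyclicInterval n r c) = r := by
  have h := pathPoint_cyclicInterval (c := c) hrn le_rfl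
  rw [pathPoint_end] at h
  simp only at h
  omega

/-- The cyclic interval of length `r` that starts at `c`, as an index of a Plücker coordinate. -/
def cyclicIndex (hrn : r ≤ n) (c : Fin n) : Index n r :=
  ⟨cyclicInterval n r c.1, card_cyclicInterval hrn c.2⟩

/-- Reversal turns "`i` lies in the interval from `c`" into "`rev c` lies in the interval from `rev
i`". -/
theorem card_filter_mem_cyclicInterval (hrn : r ≤ n) (i : Fin n) :
    #{c : Fin n | i ∈ cyclicInterval n r c.1} = r := by
  refine Eq.trans ?_ (card_cyclicInterval hrn (Fin.rev i).2)
  refine Finset.card_bij (fun c _ => Fin.rev c) ?_ ?_ ?_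
  · intro c hc
    simp only [Finset.mem_filter, Finset.mem_univ, true_and, mem_cyclicInterval] at hc
    rw [mem_cyclicInterval, Fin.val_rev, Fin.val_rev]
    have := c.2
    have := i.2
    omega
  · intro c _ d _ h
    exact Fin.rev_injective h
  · intro c hc
    refine ⟨Fin.rev c, ?_, Fin.rev_rev c⟩
    simp only [Finset.mem_filter, Finset.mem_univ, true_and, mem_cyclicInterval]
    rw [mem_cyclicInterval, Fin.val_rev] at hc
    rw [Fin.val_rev]
    have := c.2
    have := i.2
    omega

/-! ### Every arrow lies on exactly one cyclic path -/

/-- A monotone lattice path between vertices of the ladder diagram that avoids all other vertices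
follows one of the cyclic intervals. Here `y t` is the height of the path on the antidiagonal
`t`. -/
theorem exists_eq_cyclic_height {k s u : ℕ} {y : ℕ → ℕ} (hn : n = k + r) (hr : 0 < r)
    (hk : 0 < k) (hsu : s < u) (hle : ∀ t, s ≤ t → t ≤ u → y t ≤ t)
    (hstep : ∀ t, s ≤ t → t < u → y (t + 1) = y t ∨ y (t + 1) = y t + 1)
    (hbd : ∀ t, s ≤ t → t ≤ u → y t ≤ r ∧ t ≤ y t + k)
    (hbt : ∀ t, s < t → t < u → y t = 0 ∨ r ≤ y t ∨ y t = t ∨ y t + k ≤ t)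
    (hs : s = 0 ∨ (0 < y s ∧ y s < r ∧ y s < s ∧ s < y s + k))
    (ht : (u = n ∧ y u = r) ∨ (0 < y u ∧ y u < r ∧ y u < u ∧ u < y u + k)) :
    ∃ c < n, ∀ t, s ≤ t → t ≤ u → y t = min t (c + r - n) + min (t - c) r := by
  have hmono : ∀ t t', s ≤ t → t ≤ t' → t' ≤ u → y t ≤ y t' ∧ y t' ≤ y t + (t' - t) := by
    intro t t' h1 h2
    induction t', h2 using Nat.le_induction with
    | base => intro _; omega
    | succ t' h2 ih =>
      intro h3
      have := ih (by omega)
      have := hstep t' (by omega) (by omega)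
      omega
  rcases hs with rfl | hs
  · have h0 := hle 0 le_rfl (by omega)
    rcases ht with ⟨rfl, hyn⟩ | ht
    · have h01 := hstep 0 le_rfl hsu
      rw [zero_add] at h01
      rcases h01 with h1 | h1
      -- The path leaves the bottom edge at `(m, 0)`. The next point is the end or again on the
      -- boundary, so `m = k` or `r = 1`.
      · let m := Nat.findGreatest (fun t => y t = 0) u
        have hm : y m = 0 := Nat.findGreatest_spec (P := fun t => y t = 0) (Nat.zero_le _)
          (by omega)
        have hm1 : 1 ≤ m := Nat.le_findGreatest (by omega) (by omega)
        have hmu : m ≤ u := Nat.findGreatest_le _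
        have hmu' : m ≠ u := by
          intro h
          rw [h] at hm
          omega
        have hm2 : y (m + 1) ≠ 0 :=
          Nat.findGreatest_is_greatest (P := fun t => y t = 0) (Nat.lt_succ_self m) (by omega)
        have hm3 := hstep m (by omega) (by omega)
        have hm4 := hbd m (by omega) (by omega)
        refine ⟨m, by omega, fun t _ h2 => ?_⟩
        by_cases htm : t ≤ m
        · have := hmono t m (by omega) htm hmu
          omega
        · have := hmono (m + 1) t (by omega) (by omega) h2
          have := hbd t (by omega) h2
          rcases eq_or_ne (m + 1) u with h | h
          · rw [h] at hm3 hm2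
            obtain rfl : t = u := by omega
            omega
          · have := hbt (m + 1) (by omega) (by omega)
            omega
      -- The path leaves the left edge at `(0, m)`: either in the top left corner, or with `k = 1`.
      · let m := Nat.findGreatest (fun t => y t = t) u
        have hm : y m = m := Nat.findGreatest_spec (P := fun t => y t = t) (Nat.zero_le _)
          (by omega)
        have hm1 : 1 ≤ m := Nat.le_findGreatest (by omega) (by omega)
        have hmu : m ≤ u := Nat.findGreatest_le _
        have hmu' : m ≠ u := by
          intro h
          rw [h] at hm
          omega
        have hm2 : y (m + 1) ≠ m + 1 :=
          Nat.findGreatest_is_greatest (P := fun t => y t = t) (Nat.lt_succ_self m) (by omega)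
        have hm3 := hstep m (by omega) (by omega)
        have hm4 := hbd m (by omega) (by omega)
        -- For `m = r` the start `k + m` would be `n`, out of range; the same path is the interval
        -- from `0`.
        by_cases hmr : m = r
        · refine ⟨0, by omega, fun t _ h2 => ?_⟩
          have := hbd t (by omega) h2
          by_cases htm : t ≤ m
          · have := hmono t m (by omega) htm hmu
            have := hle t (by omega) h2
            omega
          · have := hmono m t (by omega) (by omega) h2
            omega
        · refine ⟨k + m, by omega, fun t _ h2 => ?_⟩
          have := hbd t (by omega) h2
          by_cases htm : t ≤ m
          · have := hmono t m (by omega) htm hmu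
            have := hle t (by omega) h2
            omega
          · have := hmono (m + 1) t (by omega) (by omega) h2
            have : m + 1 ≠ u := by
              intro h
              rw [h] at hm3
              omega
            have := hbt (m + 1) (by omega) (by omega)
            omega
    · obtain ⟨v, rfl⟩ : ∃ v, u = v + 1 := ⟨u - 1, by omega⟩
      have hb := hbt v (by omega) (by omega)
      have hv := hbd v (by omega) (by omega)
      -- The target is interior, so the last step leaves the left edge horizontally or the bottom
      -- edge vertically. This selects the horizontal or the vertical line through the target.
      rcases hstep v (by omega) (by omega) with h1 | h1
      · refine ⟨k + y (v + 1), by omega, fun t _ h2 => ?_⟩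
        rcases h2.eq_or_lt with rfl | h2
        · omega
        · have := hmono t v (by omega) (by omega) (by omega)
          have := hbd t (by omega) (by omega)
          have := hle t (by omega) (by omega)
          omega
      · refine ⟨v + 1 - y (v + 1), by omega, fun t _ h2 => ?_⟩
        rcases h2.eq_or_lt with rfl | h2
        · omega
        · have := hmono t v (by omega) (by omega) (by omega)
          have := hbd t (by omega) (by omega)
          have := hle t (by omega) (by omega)
          omega
  · have hb := hbt (s + 1) (by omega)
    have hv := hbd (s + 1) (by omega) (by omega)
    -- The source is interior, and the first step selects the line through it: horizontal gives
    -- start `k + y s`, vertical gives `s - y s`.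
    rcases hstep s (by omega) (by omega) with h1 | h1
    · refine ⟨k + y s, by omega, fun t h2 h3 => ?_⟩
      rcases h2.eq_or_lt with rfl | h2
      · omega
      · have := hmono (s + 1) t (by omega) (by omega) (by omega)
        have := hbd t (by omega) (by omega)
        by_cases hsu' : s + 1 < u
        · have := hb hsu'
          omega
        · obtain rfl : t = s + 1 := by omega
          omega
    · refine ⟨s - y s, by omega, fun t h2 h3 => ?_⟩
      rcases h2.eq_or_lt with rfl | h2
      · omega
      · have := hmono (s + 1) t (by omega) (by omega) (by omega)
        have := hbd t (by omega) (by omega)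
        by_cases hsu' : s + 1 < u
        · have := hb hsu'
          omega
        · obtain rfl : t = s + 1 := by omega
          omega

theorem isVertex_iff {p : ℕ × ℕ} : IsVertex n r p ↔ (p.1 = 0 ∧ p.2 = 0) ∨
    (p.1 = n - r ∧ p.2 = r) ∨ ((0 < p.1 ∧ p.1 < n - r) ∧ (0 < p.2 ∧ p.2 < r)) := by
  simp [IsVertex, Prod.ext_iff]

theorem Arrow.exists_inPath_cyclicInterval (hr : 0 < r) (hrn : r < n) (a : Arrow n r) :
    ∃ c : Fin n, a.InPath (cyclicInterval n r c.1) := by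
  have hun := a.tgt.level_le hrn.le
  have hsum : ∀ t, a.src.level ≤ t → t ≤ a.tgt.level →
      (pathPoint a.src.1 a.labels t).1 + (pathPoint a.src.1 a.labels t).2 = t :=
    fun t h1 h2 => pathPoint_sum _ h1 (h2.trans hun)
  have hbd : ∀ t, t ≤ a.tgt.level →
      (pathPoint a.src.1 a.labels t).1 ≤ n - r ∧ (pathPoint a.src.1 a.labels t).2 ≤ r := by
    intro t h2
    have h3 := pathPoint_mono a.src.1 a.labels h2
    rw [a.ends] at h3
    have h4 := a.tgt.2.le
    exact ⟨h3.1.trans h4.1, h3.2.trans h4.2⟩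
  have hs : pathPoint a.src.1 a.labels a.src.level = a.src.1 := pathPoint_base _ _
  have hs0 := hsum _ le_rfl a.lt.le
  have ht0 := hsum _ a.lt.le le_rfl
  have hs' := isVertex_iff.1 a.src.2
  have ht' := isVertex_iff.1 a.tgt.2
  rw [← hs] at hs'
  rw [← a.ends] at ht'
  have hlt := a.lt
  obtain ⟨y, hy⟩ : ∃ y : ℕ → ℕ, ∀ t, y t = (pathPoint a.src.1 a.labels t).2 :=
    ⟨_, fun _ => rfl⟩
  simp only [← hy] at hsum hbd hs0 ht0 hs' ht'
  obtain ⟨c, hc, h⟩ := exists_eq_cyclic_height (n := n) (r := r) (k := n - r) (y := y)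
    (by omega) hr (by omega) a.lt
    (fun t h1 h2 => by have := hsum t h1 h2; omega)
    (fun t h1 h2 => by
      have htn : t < n := by omega
      rw [hy, hy]
      by_cases hL : (⟨t, htn⟩ : Fin n) ∈ a.labels
      · exact Or.inr (by rw [pathPoint_succ_of_mem htn h1 hL])
      · exact Or.inl (by rw [pathPoint_succ_of_notMem htn h1 hL]))
    (fun t h1 h2 => by have := hsum t h1 h2; have := hbd t h2; omega)
    (fun t h1 h2 => by
      have h3 := hsum t h1.le h2.le
      by_contra! hc
      refine a.between t h1 h2 (isVertex_iff.2 (Or.inr (Or.inr ?_)))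
      rw [← hy]
      omega)
    (by omega) (by omega)
  suffices H : a.InPath (cyclicInterval n r c) from ⟨⟨c, hc⟩, H⟩
  refine Arrow.inPath_of_pathPoint_eq fun t h1 h2 => ?_
  have h3 := h t h1 h2
  have h4 := hsum t h1 h2
  have h5 := pathPoint_sum (p := (0, 0)) (cyclicInterval n r c) (Nat.zero_le t) (h2.trans hun)
  have h6 := pathPoint_cyclicInterval (c := c) hrn.le (h2.trans hun)
  rw [hy] at h3 h4
  exact Prod.ext (by omega) (by omega)

/-- As `0 < r < n`, the start is the only element whose cyclic predecessor is missing; testing `d`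
and `d - 1` detects it. -/
theorem cyclicInterval_ne (hr : 0 < r) (hrn : r < n) {c d : ℕ} (hcd : c < d) (hd : d < n) :
    cyclicInterval n r c ≠ cyclicInterval n r d := by
  intro h
  have h1 := Finset.ext_iff.1 h ⟨d, hd⟩
  have h2 := Finset.ext_iff.1 h ⟨d - 1, by omega⟩
  simp only [mem_cyclicInterval] at h1 h2
  omega

/-- Two cyclic intervals whose paths share an interior point and a step from or to it agree. -/
theorem eq_of_cyclic_height_eq {k c d t y y' : ℕ} (hn : n = k + r) (hc : c < n) (hd : d < n)
    (hy : 0 < y ∧ y < r ∧ y < t ∧ t < y + k) (h1 : y = min t (c + r - n) + min (t - c) r)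
    (h2 : y = min t (d + r - n) + min (t - d) r)
    (h : (y' = min (t + 1) (c + r - n) + min (t + 1 - c) r ∧
      y' = min (t + 1) (d + r - n) + min (t + 1 - d) r) ∨
      (y' = min (t - 1) (c + r - n) + min (t - 1 - c) r ∧
      y' = min (t - 1) (d + r - n) + min (t - 1 - d) r)) : c = d := by
  -- Just two cyclic paths pass through an interior point: along its vertical and along its
  -- horizontal line. The adjacent step tells them apart.
  have e1 : c = t - y ∨ c = k + y := by omega
  have e2 : d = t - y ∨ d = k + y := by omega
  clear h1 h2
  rcases e1 with rfl | rfl <;> rcases e2 with rfl | rfl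
  · rfl
  · omega
  · omega
  · rfl

theorem Arrow.InPath.cyclic_unique (hr : 0 < r) (hrn : r < n) {a : Arrow n r} {c d : Fin n}
    (hc : a.InPath (cyclicInterval n r c.1)) (hd : a.InPath (cyclicInterval n r d.1)) :
    c = d := by
  have hun := a.tgt.level_le hrn.le
  have hlt := a.lt
  have key : ∀ t, a.src.level ≤ t → t ≤ a.tgt.level →
      (pathPoint a.src.1 a.labels t).2 = min t (c.1 + r - n) + min (t - c.1) r ∧
      (pathPoint a.src.1 a.labels t).2 = min t (d.1 + r - n) + min (t - d.1) r := by
    intro t h1 h2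
    rw [← pathPoint_cyclicInterval hrn.le (h2.trans hun),
      ← pathPoint_cyclicInterval hrn.le (h2.trans hun), hc.pathPoint_eq hrn.le h1 h2,
      hd.pathPoint_eq hrn.le h1 h2]
    exact ⟨rfl, rfl⟩
  have hs : pathPoint a.src.1 a.labels a.src.level = a.src.1 := pathPoint_base _ _
  have hs0 : (pathPoint a.src.1 a.labels a.src.level).1 +
      (pathPoint a.src.1 a.labels a.src.level).2 = a.src.level :=
    pathPoint_sum (p := a.src.1) a.labels le_rfl (a.lt.le.trans hun)
  have ht0 := pathPoint_sum (p := a.src.1) a.labels a.lt.le hun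
  have hs' := isVertex_iff.1 a.src.2
  have ht' := isVertex_iff.1 a.tgt.2
  rw [← hs] at hs'
  rw [← a.ends] at ht'
  have k1 := key _ le_rfl hlt.le
  have k2 := key (a.src.level + 1) (by omega) (by omega)
  have k3 := key _ hlt.le le_rfl
  have k4 := key (a.tgt.level - 1) (by omega) (by omega)
  have hcn := c.2
  have hdn := d.2
  -- An arrow from corner to corner determines the whole interval. Any other arrow has an interior
  -- end, and its step at that end decides.
  by_cases hfull : a.src.level = 0 ∧ a.tgt.level = n
  · have e : cyclicInterval n r c.1 = cyclicInterval n r d.1 := by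
      ext i
      have h1 : a.src.level ≤ i.1 := by omega
      have h2 : i.1 < a.tgt.level := by omega
      rw [hc.2 i h1 h2, hd.2 i h1 h2]
    rcases lt_trichotomy c d with h | h | h
    · exact absurd e (cyclicInterval_ne hr hrn h hdn)
    · exact h
    · exact absurd e.symm (cyclicInterval_ne hr hrn h hcn)
  · refine Fin.ext ?_
    by_cases h0 : a.src.level = 0
    · exact eq_of_cyclic_height_eq (k := n - r) (by omega) hcn hdn (by clear k1 k2 k3 k4; omega)
        k3.1 k3.2 (Or.inr k4)
    · exact eq_of_cyclic_height_eq (k := n - r) (by omega) hcn hdn (by clear k1 k2 k3 k4; omega)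
        k1.1 k1.2 (Or.inl k2)

theorem prod_eq_prod_weight_cyclicIndex (hr : 0 < r) (hrn : r < n) (ψ : Arrow n r → ℂˣ) :
    ∏ a, ψ a = ∏ c, weight ψ (cyclicIndex hrn.le c) := by
  classical
  have h : ∀ c, weight ψ (cyclicIndex hrn.le c) =
      ∏ a : Arrow n r, if a.InPath (cyclicInterval n r c.1) then ψ a else 1 := by
    intro c
    rw [weight, Finset.prod_filter]
    exact Finset.prod_congr rfl fun a _ => by congr
  simp_rw [h]
  rw [Finset.prod_comm]
  refine Finset.prod_congr rfl fun a _ => ?_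
  obtain ⟨c, hc⟩ := a.exists_inPath_cyclicInterval hr hrn
  rw [Finset.prod_eq_single c, if_pos hc]
  · exact fun d _ hdc => if_neg fun hd => hdc (hd.cyclic_unique hr hrn hc)
  · simp

theorem prod_prod_cyclicInterval {M : Type*} [CommMonoid M] (hrn : r ≤ n) (ζ : Fin n → M) :
    ∏ c : Fin n, ∏ i ∈ cyclicInterval n r c.1, ζ i = (∏ i, ζ i) ^ r := by
  have h : ∀ c : Fin n, ∏ i ∈ cyclicInterval n r c.1, ζ i =
      ∏ i, if i ∈ cyclicInterval n r c.1 then ζ i else 1 := by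
    intro c
    rw [Finset.prod_ite_mem, Finset.univ_inter]
  simp_rw [h]
  rw [Finset.prod_comm, ← Finset.prod_pow]
  refine Finset.prod_congr rfl fun i _ => ?_
  rw [← Finset.prod_filter, Finset.prod_const, card_filter_mem_cyclicInterval hrn]

theorem psiTilde_mem_gTilde (hr : 0 < r) (hrn : r < n) {ζ : Fin n → ℂˣ} (hζ : ζ ∈ HTilde n r) :
    PsiTilde n r ζ ∈ GTilde n r := by
  refine ⟨fun a => ?_, ?_⟩
  · rw [PsiTilde, ← Finset.prod_pow]
    exact Finset.prod_eq_one fun i _ => hζ.1 i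
  · rw [prod_eq_prod_weight_cyclicIndex hr hrn]
    simp_rw [weight_psiTilde hrn.le]
    exact (prod_prod_cyclicInterval hrn.le ζ).trans hζ.2

/-! ### Elements with constant weight lie in the torus -/

/-- The path that follows `I` below the antidiagonal `t` and `J` from there on. -/
def splice (I J : Finset (Fin n)) (t : ℕ) : Finset (Fin n) :=
  {i ∈ I | i.1 < t} ∪ {i ∈ J | t ≤ i.1}

theorem mem_splice_of_lt {I J : Finset (Fin n)} {t : ℕ} {i : Fin n} (h : i.1 < t) :
    i ∈ splice I J t ↔ i ∈ I := by
  simp [splice, h]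

theorem mem_splice_of_le {I J : Finset (Fin n)} {t : ℕ} {i : Fin n} (h : t ≤ i.1) :
    i ∈ splice I J t ↔ i ∈ J := by
  simp [splice, h]

theorem pathPoint_splice_of_le {I J : Finset (Fin n)} {t l : ℕ} (ht : t ≤ n) (hl : l ≤ t) :
    pathPoint (0, 0) (splice I J t) l = pathPoint (0, 0) I l := by
  refine pathPoint_congr (s := 0) ht le_rfl le_rfl ?_ (fun i _ h => mem_splice_of_lt h)
    (Nat.zero_le _) hl
  rw [pathPoint_zero, pathPoint_zero]

theorem pathPoint_splice_of_ge {I J : Finset (Fin n)} {t l : ℕ}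
    (h : pathPoint (0, 0) I t = pathPoint (0, 0) J t) (htl : t ≤ l) (hl : l ≤ n) :
    pathPoint (0, 0) (splice I J t) l = pathPoint (0, 0) J l :=
  pathPoint_congr le_rfl (Nat.zero_le _) (Nat.zero_le _)
    ((pathPoint_splice_of_le (htl.trans hl) le_rfl).trans h)
    (fun _ h _ => mem_splice_of_le h) htl hl

theorem card_splice {I J : Finset (Fin n)} {t : ℕ} (ht : t ≤ n)
    (h : pathPoint (0, 0) I t = pathPoint (0, 0) J t) : #(splice I J t) = #J := by
  have := pathPoint_splice_of_ge h ht le_rfl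
  rw [pathPoint_end, pathPoint_end] at this
  exact congrArg Prod.snd this

theorem Arrow.inPath_splice_of_le {a : Arrow n r} {I J : Finset (Fin n)} {t : ℕ} (ht : t ≤ n)
    (ha : a.tgt.level ≤ t) : a.InPath (splice I J t) ↔ a.InPath I := by
  rw [Arrow.InPath, Arrow.InPath, pathPoint_splice_of_le ht (a.lt.le.trans ha)]
  refine and_congr_right fun _ => forall₃_congr fun i _ h => ?_
  rw [mem_splice_of_lt (h.trans_le ha)]

theorem Arrow.inPath_splice_of_ge (hrn : r ≤ n) {a : Arrow n r} {I J : Finset (Fin n)} {t : ℕ}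
    (h : pathPoint (0, 0) I t = pathPoint (0, 0) J t) (ha : t ≤ a.src.level) :
    a.InPath (splice I J t) ↔ a.InPath J := by
  rw [Arrow.InPath, Arrow.InPath, pathPoint_splice_of_ge h ha (a.src.level_le hrn)]
  refine and_congr_right fun _ => forall₃_congr fun i h _ => ?_
  rw [mem_splice_of_le (ha.trans h)]

open Classical in
/-- The part of the weight of a path that comes from the arrows below the antidiagonal `t`. -/
def preWeight (ψ : Arrow n r → ℂˣ) (I : Finset (Fin n)) (t : ℕ) : ℂˣ :=
  ∏ a : Arrow n r with a.InPath I ∧ a.tgt.level ≤ t, ψ a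

open Classical in
/-- The part of the weight of a path that comes from the arrows above the antidiagonal `t`. -/
def postWeight (ψ : Arrow n r → ℂˣ) (I : Finset (Fin n)) (t : ℕ) : ℂˣ :=
  ∏ a : Arrow n r with a.InPath I ∧ t ≤ a.src.level, ψ a

theorem weight_eq_preWeight_mul_postWeight (hrn : r ≤ n) (ψ : Arrow n r → ℂˣ) (I : Index n r)
    {t : ℕ} (ht : IsVertex n r (pathPoint (0, 0) I.1 t)) :
    weight ψ I = preWeight ψ I.1 t * postWeight ψ I.1 t := by
  classical
  rw [weight, preWeight, postWeight, ← Finset.prod_union]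
  · refine Finset.prod_congr ?_ fun _ _ => rfl
    ext a
    simp only [Finset.mem_filter, Finset.mem_univ, true_and, Finset.mem_union, ← and_or_left]
    exact ⟨fun h => ⟨h, (h.level_le_or hrn ht).symm⟩, fun h => h.1⟩
  · refine Finset.disjoint_left.2 fun a h1 h2 => ?_
    have h1 := (Finset.mem_filter.1 h1).2.2
    have h2 := (Finset.mem_filter.1 h2).2.2
    have := a.lt
    omega

/-- The arrow that ends at a vertex splits off from the weight of the path up to this vertex. -/
theorem preWeight_tgt (hrn : r ≤ n) (ψ : Arrow n r → ℂˣ) {a : Arrow n r} {I : Finset (Fin n)}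
    (ha : a.InPath I) : preWeight ψ I a.tgt.level = preWeight ψ I a.src.level * ψ a := by
  classical
  rw [mul_comm, preWeight, preWeight]
  have h : a ∉ (Finset.univ.filter fun b : Arrow n r =>
      b.InPath I ∧ b.tgt.level ≤ a.src.level) := by
    have := a.lt
    simp only [Finset.mem_filter, Finset.mem_univ, true_and, not_and]
    omega
  rw [← Finset.prod_insert h]
  refine Finset.prod_congr ?_ fun _ _ => rfl
  ext b
  simp only [Finset.mem_filter, Finset.mem_univ, true_and, Finset.mem_insert]
  have hlt := a.lt
  constructor
  · rintro ⟨hb, hba⟩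
    rcases ha.level_le_or hrn (hb.isVertex_tgt hrn) with h1 | h1
    · exact Or.inr ⟨hb, h1⟩
    · have := b.lt
      exact Or.inl (hb.eq hrn ha (t := a.tgt.level - 1)
        (by omega) (by omega) (by omega) (by omega))
  · rintro (rfl | ⟨hb, h⟩)
    · exact ⟨ha, le_rfl⟩
    · exact ⟨hb, by omega⟩

/-- Splice `I` below the common vertex with `J` above it. The new path and `J` have the same total
weight and the same upper part, so their lower parts agree. -/
theorem preWeight_eq_of_weight_const (hrn : r ≤ n) {ψ : Arrow n r → ℂˣ} {c : ℂˣ}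
    (hc : ∀ I : Index n r, weight ψ I = c) (I J : Index n r) {t : ℕ} (ht : t ≤ n)
    (h : pathPoint (0, 0) I.1 t = pathPoint (0, 0) J.1 t)
    (hI : IsVertex n r (pathPoint (0, 0) I.1 t)) : preWeight ψ I.1 t = preWeight ψ J.1 t := by
  classical
  let K : Index n r := ⟨splice I.1 J.1 t, (card_splice ht h).trans J.2⟩
  have hK : pathPoint (0, 0) K.1 t = pathPoint (0, 0) I.1 t := pathPoint_splice_of_le ht le_rfl
  have h1 := weight_eq_preWeight_mul_postWeight hrn ψ K (hK ▸ hI)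
  have h2 := weight_eq_preWeight_mul_postWeight hrn ψ J (h ▸ hI)
  have h3 : preWeight ψ K.1 t = preWeight ψ I.1 t := by
    refine Finset.prod_congr (Finset.filter_congr fun a _ => ?_) fun _ _ => rfl
    exact and_congr_left fun ha => Arrow.inPath_splice_of_le ht ha
  have h4 : postWeight ψ K.1 t = postWeight ψ J.1 t := by
    refine Finset.prod_congr (Finset.filter_congr fun a _ => ?_) fun _ _ => rfl
    exact and_congr_left fun ha => Arrow.inPath_splice_of_ge hrn h ha
  rw [hc, h3, h4] at h1
  rw [hc, h1] at h2
  exact mul_right_cancel h2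

/-- The interval that starts at the horizontal coordinate of `v` works: its path runs along the
bottom edge and then up through `v`. -/
theorem exists_index_through (hrn : r < n) (v : Vertex n r) :
    ∃ I : Index n r, pathPoint (0, 0) I.1 v.level = v.1 := by
  have h := v.2.le
  have hn := v.level_le hrn.le
  have hl : v.level = v.1.1 + v.1.2 := rfl
  have h5 := pathPoint_sum (p := (0, 0)) (cyclicInterval n r v.1.1) (Nat.zero_le v.level) hn
  have h6 := pathPoint_cyclicInterval (c := v.1.1) hrn.le hn
  have h7 : #(cyclicInterval n r v.1.1) = r := by
    have h := pathPoint_cyclicInterval (c := v.1.1) hrn.le le_rfl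
    rw [pathPoint_end] at h
    simp only at h
    omega
  exact ⟨⟨cyclicInterval n r v.1.1, h7⟩, Prod.ext (by simp only; omega) (by simp only; omega)⟩

/-- Take for `τ_v` the weight of the arrows before `v` on any path through `v`. Extending such a
path by an arrow `a` multiplies this weight by `ψ_a`. -/
theorem mem_torus_of_weight_const (hr : 0 < r) (hrn : r < n) {ψ : Arrow n r → ℂˣ} {c : ℂˣ}
    (hc : ∀ I : Index n r, weight ψ I = c) : ψ ∈ Torus n r := by
  choose I hI using exists_index_through hrn
  have key : ∀ (v : Vertex n r) (J : Index n r), pathPoint (0, 0) J.1 v.level = v.1 →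
      preWeight ψ J.1 v.level = preWeight ψ (I v).1 v.level := by
    intro v J hJ
    exact preWeight_eq_of_weight_const hrn.le hc J (I v) (v.level_le hrn.le)
      (hJ.trans (hI v).symm) (hJ ▸ v.2)
  refine ⟨fun v => preWeight ψ (I v).1 v.level, ?_, fun a => ?_⟩
  · classical
    refine Finset.prod_eq_one fun a ha => ?_
    have h1 := (Finset.mem_filter.1 ha).2.2
    have h2 := a.lt
    rw [Vertex.level_zero] at h1
    omega
  · obtain ⟨d, hd⟩ := a.exists_inPath_cyclicInterval hr hrn
    have h1 : preWeight ψ (cyclicIndex hrn.le d).1 a.tgt.level =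
        preWeight ψ (cyclicIndex hrn.le d).1 a.src.level * ψ a := preWeight_tgt hrn.le ψ hd
    rw [key a.tgt (cyclicIndex hrn.le d) (hd.pathPoint_tgt hrn.le),
      key a.src (cyclicIndex hrn.le d) hd.1] at h1
    simp only
    rw [h1, inv_mul_cancel_left]

/-! ### Homogeneity of the Plücker relations -/

/-- A set of size `r` as an index of a Plücker coordinate. -/
def toIndex (S : Finset (Fin n)) (h : #S = r) : Index n r := ⟨S, h⟩

theorem coord_of_card {S : Finset (Fin n)} (h : #S = r) :
    coord r S = MvPolynomial.X (toIndex S h) := dif_pos h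

theorem coord_of_card_ne {S : Finset (Fin n)} (h : #S ≠ r) : coord r S = 0 := dif_neg h

theorem neg_one_pow_eq_C (e : ℕ) :
    ((-1) ^ e : MvPolynomial (Index n r) ℂ) = MvPolynomial.C ((-1) ^ e) := by
  simp

theorem coeff_sign_mul_X_mul_X [DecidableEq (Index n r)] (e : ℕ) (I J : Index n r)
    (m : Index n r →₀ ℕ) :
    MvPolynomial.coeff m ((-1) ^ e * (MvPolynomial.X I * MvPolynomial.X J) :
      MvPolynomial (Index n r) ℂ) =
      if Finsupp.single I 1 + Finsupp.single J 1 = m then (-1) ^ e else 0 := by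
  rw [neg_one_pow_eq_C, MvPolynomial.coeff_C_mul, MvPolynomial.X, MvPolynomial.X,
    MvPolynomial.monomial_mul, MvPolynomial.coeff_monomial]
  simp

theorem monomialWeight_single_add_single (ψ : Arrow n r → ℂˣ) (I J : Index n r) :
    monomialWeight ψ (Finsupp.single I 1 + Finsupp.single J 1) = weight ψ I * weight ψ J := by
  rw [monomialWeight, Finsupp.prod_add_index' (by simp) (fun _ _ _ => pow_add _ _ _)]
  simp

theorem single_add_single_eq {α : Type*} {a b c d : α}
    (h : Finsupp.single a 1 + Finsupp.single b 1 =
      (Finsupp.single c 1 + Finsupp.single d 1 : α →₀ ℕ)) :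
    (a = c ∧ b = d) ∨ (a = d ∧ b = c) := by
  rcases (Finsupp.single_add_single_eq_single_add_single one_ne_zero one_ne_zero).1 h with
    h | h | h | h
  · exact Or.inl ⟨h.1, h.2⟩
  all_goals simp_all

/-- A weight that is multiplicative in the elements of the index sets makes all Plücker relations
homogeneous. -/
theorem preservesPlucker_of_weight {ψ : Arrow n r → ℂˣ} (ζ : Fin n → ℂˣ)
    (h : ∀ I : Index n r, weight ψ I = ∏ i ∈ I.1, ζ i) : PreservesPlucker ψ := by
  classical
  intro A B C hAB hC
  suffices H : ∀ m ∈ (pluckerRelation r A B C).support, monomialWeight ψ m =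
      (∏ i ∈ A, ζ i) * (∏ i ∈ B, ζ i) * ∏ i ∈ C, ζ i by
    intro m hm m' hm'
    rw [H m hm, H m' hm']
  intro m hm
  rw [MvPolynomial.mem_support_iff, pluckerRelation, MvPolynomial.coeff_sum] at hm
  obtain ⟨D, hD, hm⟩ := Finset.exists_ne_zero_of_sum_ne_zero hm
  rw [Finset.mem_powersetCard] at hD
  have hCD : #(C \ D) = #C - #D := Finset.card_sdiff_of_subset hD.1
  -- A repeated index makes a union too small, so its coordinate is `0`. In the surviving terms both
  -- unions are disjoint and the weight depends only on `A`, `B`, `C`.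
  by_cases h1 : #(A ∪ D) = r
  swap
  · simp [coord_of_card_ne h1] at hm
  by_cases h2 : #((C \ D) ∪ B) = r
  swap
  · simp [coord_of_card_ne h2] at hm
  rw [coord_of_card h1, coord_of_card h2, coeff_sign_mul_X_mul_X] at hm
  split_ifs at hm with e
  swap
  · exact absurd rfl hm
  have d1 : Disjoint A D := by
    rw [← Finset.card_union_eq_card_add_card]
    omega
  have d2 : Disjoint (C \ D) B := by
    rw [← Finset.card_union_eq_card_add_card]
    omega
  rw [← e, monomialWeight_single_add_single, h, h, toIndex, toIndex, Finset.prod_union d1, Finset.prod_union d2,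
    ← Finset.prod_sdiff hD.1]
  ac_rfl

/-- The exchange rule: if all Plücker relations are homogeneous, then the ratio of the weights of
`S ∪ {i}` and `S ∪ {j}` does not depend on `S`. -/
theorem PreservesPlucker.exchange {ψ : Arrow n r → ℂˣ} (h : PreservesPlucker ψ)
    {S T : Finset (Fin n)} {i j : Fin n} (hij : i ≠ j) (hiS : i ∉ S) (hjS : j ∉ S) (hiT : i ∉ T)
    (hjT : j ∉ T) (h1 : #(insert i S) = r) (h2 : #(insert j S) = r) (h3 : #(insert i T) = r)
    (h4 : #(insert j T) = r) :
    weight ψ (toIndex (insert i S) h1) * weight ψ (toIndex (insert j T) h4) =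
      weight ψ (toIndex (insert j S) h2) * weight ψ (toIndex (insert i T) h3) := by
  classical
  -- For `S = T` the two monomials coincide and could cancel, but the claim is then mere
  -- commutativity.
  by_cases hST : S = T
  · subst hST
    exact mul_comm _ _
  have cS := Finset.card_insert_of_notMem hiS
  have cT := Finset.card_insert_of_notMem hjT
  -- In the relation with `A = S`, `B = ∅`, `C = T ∪ {i, j}`, only the splitting `C₁ = {i}` produces
  -- this monomial, so nothing cancels it.
  have key : ∀ (i j : Fin n), i ≠ j → i ∉ S → j ∉ S → i ∉ T → j ∉ T →
      ∀ (h1 : #(insert i S) = r) (h4 : #(insert j T) = r),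
      (Finsupp.single (toIndex (insert i S) h1) 1 + Finsupp.single (toIndex (insert j T) h4) 1 : Index n r →₀ ℕ) ∈
        (pluckerRelation r S ∅ (insert i (insert j T))).support := by
    intro i j hij hiS hjS hiT hjT h1 h4
    have hiT' : i ∉ insert j T := by simp [hij, hiT]
    have hsd : insert i (insert j T) \ {i} = insert j T := by
      rw [Finset.sdiff_singleton_eq_erase, Finset.erase_insert hiT']
    rw [MvPolynomial.mem_support_iff, pluckerRelation, MvPolynomial.coeff_sum,
      Finset.sum_eq_single {i}]
    · have hu : S ∪ {i} = insert i S := by rw [Finset.union_comm]; rfl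
      simp only [hsd, hu, Finset.union_empty]
      rw [coord_of_card h1, coord_of_card h4, coeff_sign_mul_X_mul_X, if_pos rfl]
      exact pow_ne_zero _ (neg_ne_zero.2 one_ne_zero)
    · intro D hD hDi
      rw [Finset.mem_powersetCard, show r - #S = 1 by omega, Finset.card_eq_one] at hD
      obtain ⟨hDs, d, rfl⟩ := hD
      rw [Finset.singleton_subset_iff] at hDs
      have hdi : d ≠ i := fun e => hDi (by rw [e])
      rw [Finset.union_empty]
      by_cases e1 : #(S ∪ {d}) = r
      swap
      · rw [coord_of_card_ne e1]
        simp
      by_cases e2 : #(insert i (insert j T) \ {d}) = r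
      swap
      · rw [coord_of_card_ne e2]
        simp
      rw [coord_of_card e1, coord_of_card e2, coeff_sign_mul_X_mul_X, if_neg]
      intro e
      rcases single_add_single_eq e with ⟨e, -⟩ | ⟨e, e'⟩
      · have e := congrArg Subtype.val e
        have hi : i ∈ S ∪ {d} := by simp only [toIndex] at e; rw [e]; simp
        simp [hiS, hdi.symm] at hi
      · have e := congrArg Subtype.val e
        have e' := congrArg Subtype.val e'
        simp only [toIndex] at e e'
        -- With the two factors interchanged, `d` must be `j`, and erasing `j` then gives the
        -- excluded case `S = T`.
        have hjd : j = d := by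
          by_contra hjd
          have hj : j ∈ insert i (insert j T) \ {d} := by simp [hjd]
          rw [e'] at hj
          simp [hjS, hij.symm] at hj
        subst hjd
        refine hST ?_
        rw [Finset.union_comm] at e
        have := congrArg (Finset.erase · j) e
        change (insert j S).erase j = (insert j T).erase j at this
        rwa [Finset.erase_insert hjS, Finset.erase_insert hjT] at this
    · intro hD
      refine absurd ?_ hD
      rw [Finset.mem_powersetCard]
      exact ⟨by simp, by rw [Finset.card_singleton]; omega⟩
  have m1 := key i j hij hiS hjS hiT hjT h1 h4
  have m2 := key j i hij.symm hjS hiS hjT hiT h2 h3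
  rw [Finset.insert_comm] at m2
  have := h S ∅ (insert i (insert j T)) (by simp; omega)
    (by rw [Finset.card_insert_of_notMem (by simp [hij, hiT])]; omega) _ m1 _ m2
  rwa [monomialWeight_single_add_single, monomialWeight_single_add_single] at this

/-! ### The action on the Grassmannian -/

theorem diagMap_apply (ζ : Fin n → ℂˣ) (v : Fin n → ℂ) (i : Fin n) :
    diagMap ζ v i = ζ i * v i := by
  simp [diagMap]

theorem actsTriviallyOnGr_of_const {ζ : Fin n → ℂˣ} {c : ℂˣ} (h : ∀ i, ζ i = c) :
    ActsTriviallyOnGr n r ζ := by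
  intro W _
  have e : ∀ v, diagMap ζ v = (c : ℂ) • v := by
    intro v
    ext i
    rw [diagMap_apply, h, Pi.smul_apply, smul_eq_mul]
  ext v
  rw [Submodule.mem_map]
  constructor
  · rintro ⟨w, hw, rfl⟩
    rw [e]
    exact W.smul_mem _ hw
  · intro hv
    exact ⟨((c⁻¹ : ℂˣ) : ℂ) • v, W.smul_mem _ hv, by rw [e, smul_smul]; simp⟩

/-- For `i ∈ I` and `j ∉ I` there is a subspace of dimension `#I` on which the coordinates `i` and
`j` agree, and which contains a vector whose coordinate `i` is `1`. -/
theorem exists_submodule_coord_eq {I : Finset (Fin n)} {i j : Fin n} (hi : i ∈ I) (hj : j ∉ I) :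
    ∃ W : Submodule ℂ (Fin n → ℂ), Module.finrank ℂ W = #I ∧ (∀ v ∈ W, v i = v j) ∧
      ∃ v ∈ W, v i = 1 := by
  -- The standard basis vectors indexed by `I`, with `e_i` replaced by `e_i + e_j`.
  let b : I → Fin n → ℂ := fun l m => if m = l.1 then 1 else if m = j ∧ l.1 = i then 1 else 0
  have hb : ∀ l m : I, b l m.1 = if m = l then 1 else 0 := by
    intro l m
    have : m.1 ≠ j := fun e => hj (e ▸ m.2)
    simp [b, this]
  have hli : LinearIndependent ℂ b := by
    rw [Fintype.linearIndependent_iff]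
    intro g hg l
    have := congrFun hg l.1
    simpa [Finset.sum_apply, hb] using this
  refine ⟨Submodule.span ℂ (Set.range b), ?_, ?_, b ⟨i, hi⟩, Submodule.subset_span ⟨_, rfl⟩, ?_⟩
  · rw [finrank_span_eq_card hli, Fintype.card_coe]
  · intro v hv
    induction hv using Submodule.span_induction with
    | mem v hv =>
      obtain ⟨l, rfl⟩ := hv
      have h1 : j ≠ l.1 := fun e => hj (e ▸ l.2)
      have h2 : i ≠ j := fun e => hj (e ▸ hi)
      simp [b, h1, h2, eq_comm]
    | zero => rfl
    | add v w _ _ hv hw => rw [Pi.add_apply, Pi.add_apply, hv, hw]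
    | smul c v _ hv => rw [Pi.smul_apply, Pi.smul_apply, hv]
  · simp [b]

/-- An invariant subspace on which the coordinates `i` and `j` agree, but do not vanish identically,
forces `ζ i = ζ j`. Since `0 < r < n`, one of dimension `r` exists. -/
theorem ActsTriviallyOnGr.const (hr : 0 < r) (hrn : r < n) {ζ : Fin n → ℂˣ}
    (h : ActsTriviallyOnGr n r ζ) (i j : Fin n) : ζ i = ζ j := by
  by_cases hij : i = j
  · rw [hij]
  obtain ⟨I, hiI, hIj, hI⟩ := Finset.exists_subsuperset_card_eq (s := {i}) (t := {j}ᶜ) (n := r)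
    (by simpa [eq_comm] using hij) (by rw [Finset.card_singleton]; omega) (by simp [Finset.card_compl]; omega)
  obtain ⟨W, hW, hWij, v, hv, hv1⟩ := exists_submodule_coord_eq (I := I) (i := i) (j := j)
    (hiI (Finset.mem_singleton_self i)) (fun hj => by simpa using hIj hj)
  have h1 : diagMap ζ v ∈ W := by
    rw [← h W (hW.trans hI)]
    exact Submodule.mem_map_of_mem hv
  have h2 := hWij _ h1
  rw [diagMap_apply, diagMap_apply, ← hWij v hv, hv1, mul_one, mul_one] at h2
  exact Units.ext h2

theorem mem_hScalar_iff (hr : 0 < r) (hrn : r < n) (ζ : HTilde n r) :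
    ζ ∈ HScalar n r ↔ ActsTriviallyOnGr n r ζ.1 := by
  constructor
  · rintro ⟨c, hc⟩
    exact actsTriviallyOnGr_of_const hc
  · intro h
    exact ⟨ζ.1 ⟨0, by omega⟩, fun i => h.const hr hrn _ _⟩

/-! ### Weights that satisfy the exchange rule -/

theorem exists_toIndex_insert (hr : 0 < r) (hrn : r < n) {i j : Fin n} (hij : i ≠ j) :
    ∃ S : Finset (Fin n), i ∉ S ∧ j ∉ S ∧ #(insert i S) = r ∧ #(insert j S) = r := by
  obtain ⟨S, hS, hc⟩ := Finset.exists_subset_card_eq (s := ({i, j}ᶜ : Finset (Fin n))) (n := r - 1)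
    (by rw [Finset.card_compl, Finset.card_pair hij, Fintype.card_fin]; omega)
  have hi : i ∉ S := fun h => by simpa using hS h
  have hj : j ∉ S := fun h => by simpa using hS h
  exact ⟨S, hi, hj, by rw [Finset.card_insert_of_notMem hi]; omega,
    by rw [Finset.card_insert_of_notMem hj]; omega⟩

/-- A function on the sets of size `r` for which `ζ` describes the effect of the exchange of an
element is, up to a constant, the product of the values of `ζ`. -/
theorem mul_prod_eq_mul_prod {M : Type*} [CommGroup M] {w : Index n r → M} {ζ : Fin n → M}
    (h : ∀ (i j : Fin n) (S : Finset (Fin n)), i ∉ S → j ∉ S →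
      ∀ (h1 : #(insert i S) = r) (h2 : #(insert j S) = r),
      ζ j * w (toIndex (insert i S) h1) = ζ i * w (toIndex (insert j S) h2))
    (I J : Index n r) : w I * ∏ i ∈ J.1, ζ i = w J * ∏ i ∈ I.1, ζ i := by
  obtain ⟨m, hm⟩ : ∃ m, #(I.1 \ J.1) = m := ⟨_, rfl⟩
  -- Each step moves `I` closer to `J` by exchanging some `i ∈ I \ J` for some `j ∈ J \ I`.
  induction m generalizing I with
  | zero =>
    rw [Finset.card_eq_zero, Finset.sdiff_eq_empty_iff_subset] at hm
    have : I = J := Subtype.ext (Finset.eq_of_subset_of_card_le hm (by rw [I.2, J.2]))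
    rw [this]
  | succ m ih =>
    obtain ⟨i, hi⟩ : (I.1 \ J.1).Nonempty := by
      rw [← Finset.card_pos]
      omega
    have hc : #(J.1 \ I.1) = #(I.1 \ J.1) :=
      (Finset.card_sdiff_comm (I.2.trans J.2.symm)).symm
    obtain ⟨j, hj⟩ : (J.1 \ I.1).Nonempty := by
      rw [← Finset.card_pos]
      omega
    have hi' := Finset.mem_sdiff.1 hi
    have hj' := Finset.mem_sdiff.1 hj
    have hiS : i ∉ I.1.erase i := Finset.notMem_erase i _
    have hjS : j ∉ I.1.erase i := fun h => hj'.2 (Finset.mem_of_mem_erase h)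
    have e : insert i (I.1.erase i) = I.1 := Finset.insert_erase hi'.1
    have h1 : #(insert i (I.1.erase i)) = r := by rw [e, I.2]
    have h2 : #(insert j (I.1.erase i)) = r := by
      rw [Finset.card_insert_of_notMem hjS, ← Finset.card_insert_of_notMem hiS, h1]
    have hex := h i j _ hiS hjS h1 h2
    have hI : toIndex (insert i (I.1.erase i)) h1 = I := Subtype.ext e
    have hIH := ih (toIndex (insert j (I.1.erase i)) h2) (by
      have : insert j (I.1.erase i) \ J.1 = (I.1 \ J.1).erase i := by
        rw [Finset.insert_sdiff_of_mem _ hj'.1, Finset.erase_sdiff_comm]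
      rw [toIndex, this, Finset.card_erase_of_mem hi, hm, Nat.add_sub_cancel])
    have e1 : ∏ l ∈ (toIndex (insert j (I.1.erase i)) h2).1, ζ l =
        ζ j * ∏ l ∈ I.1.erase i, ζ l := Finset.prod_insert hjS
    rw [e1] at hIH
    rw [hI] at hex
    rw [← Finset.mul_prod_erase _ _ hi'.1]
    refine mul_left_cancel (a := ζ j) ?_
    rw [← mul_assoc, hex, mul_assoc, hIH]
    ac_rfl

/-- With a fixed reference element `o`, let `ζ i` be the ratio of the values at `S ∪ {i}` and `S ∪
{o}`. The exchange rule makes it independent of `S`, and quotients of `N`-th roots of unity are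
again such roots. -/
theorem exists_of_exchange {M : Type*} [CommGroup M] (hr : 0 < r) (hrn : r < n)
    {w : Index n r → M} {N : ℕ} (hw : ∀ I, w I ^ N = 1)
    (h : ∀ (i j : Fin n) (S T : Finset (Fin n)), i ≠ j → i ∉ S → j ∉ S → i ∉ T → j ∉ T →
      ∀ (h1 : #(insert i S) = r) (h2 : #(insert j S) = r) (h3 : #(insert i T) = r)
        (h4 : #(insert j T) = r),
      w (toIndex (insert i S) h1) * w (toIndex (insert j T) h4) =
        w (toIndex (insert j S) h2) * w (toIndex (insert i T) h3)) :
    ∃ (c : M) (ζ : Fin n → M), c ^ N = 1 ∧ (∀ i, ζ i ^ N = 1) ∧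
      ∀ I, w I = c * ∏ i ∈ I.1, ζ i := by
  let o : Fin n := ⟨0, by omega⟩
  have hζ : ∀ i, ∃ z : M, z ^ N = 1 ∧ ∀ S : Finset (Fin n), i ∉ S → o ∉ S →
      ∀ (h1 : #(insert i S) = r) (h2 : #(insert o S) = r),
      w (toIndex (insert i S) h1) = z * w (toIndex (insert o S) h2) := by
    intro i
    by_cases hi : i = o
    · exact ⟨1, one_pow _, fun S _ _ h1 h2 => by subst hi; rw [one_mul]⟩
    · obtain ⟨S, hiS, hoS, h1, h2⟩ := exists_toIndex_insert hr hrn hi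
      refine ⟨w (toIndex (insert i S) h1) / w (toIndex (insert o S) h2), ?_, ?_⟩
      · rw [div_pow, hw, hw, div_one]
      · intro T hiT hoT h3 h4
        rw [div_mul_eq_mul_div, eq_div_iff_mul_eq', mul_comm,
          h i o S T hi hiS hoS hiT hoT h1 h2 h3 h4]
  choose ζ hζN hζ using hζ
  have key : ∀ (i j : Fin n) (S : Finset (Fin n)), i ∉ S → j ∉ S →
      ∀ (h1 : #(insert i S) = r) (h2 : #(insert j S) = r),
      ζ j * w (toIndex (insert i S) h1) = ζ i * w (toIndex (insert j S) h2) := by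
    intro i j S hiS hjS h1 h2
    by_cases hij : i = j
    · subst hij
      rfl
    -- If `S = R ∪ {o}`, the ratios cannot be taken over `S`. Taken over `R ∪ {j}` and `R ∪ {i}`,
    -- they turn both sides into the value at `R ∪ {i, j}`.
    by_cases hoS : o ∈ S
    · obtain ⟨R, hoR, rfl⟩ : ∃ R, o ∉ R ∧ insert o R = S :=
        ⟨S.erase o, Finset.notMem_erase o S, Finset.insert_erase hoS⟩
      rw [Finset.mem_insert, not_or] at hiS hjS
      have e : ∀ a : Fin n, insert a (insert o R) = insert o (insert a R) := fun a =>
        Finset.insert_comm _ _ _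
      have h1' : #(insert o (insert i R)) = r := by rw [← e, h1]
      have h2' : #(insert o (insert j R)) = r := by rw [← e, h2]
      have hnot : ∀ a b : Fin n, a ≠ b → a ∉ R → a ∉ insert b R := fun a b hab ha => by
        rw [Finset.mem_insert, not_or]
        exact ⟨hab, ha⟩
      have hij' := hnot i j hij hiS.2
      have hji' := hnot j i (Ne.symm hij) hjS.2
      have hoi := hnot o i (Ne.symm hiS.1) hoR
      have hoj := hnot o j (Ne.symm hjS.1) hoR
      have h3 : #(insert i (insert j R)) = r := by
        rw [Finset.card_insert_of_notMem hij', ← Finset.card_insert_of_notMem hoj, h2']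
      have h3' : #(insert j (insert i R)) = r := by rw [Finset.insert_comm, h3]
      have k1 := hζ i (insert j R) hij' hoj h3 h2'
      have k2 := hζ j (insert i R) hji' hoi h3' h1'
      have e1 : toIndex (insert i (insert o R)) h1 = toIndex (insert o (insert i R)) h1' :=
        Subtype.ext (e i)
      have e2 : toIndex (insert j (insert o R)) h2 = toIndex (insert o (insert j R)) h2' :=
        Subtype.ext (e j)
      have e3 : toIndex (insert i (insert j R)) h3 = toIndex (insert j (insert i R)) h3' :=
        Subtype.ext (Finset.insert_comm _ _ _)
      rw [e1, e2, ← k1, ← k2, e3]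
    · have h3 : #(insert o S) = r := by
        rw [← h1, Finset.card_insert_of_notMem hoS, Finset.card_insert_of_notMem hiS]
      rw [hζ i S hiS hoS h1 h3, hζ j S hjS hoS h2 h3]
      exact mul_left_comm _ _ _
  have hc := mul_prod_eq_mul_prod key
  let J : Index n r := cyclicIndex hrn.le o
  refine ⟨w J / ∏ i ∈ J.1, ζ i, ζ, ?_, hζN, fun I => ?_⟩
  · rw [div_pow, hw, ← Finset.prod_pow, Finset.prod_eq_one fun i _ => hζN i, div_one]
  · rw [div_mul_eq_mul_div, eq_div_iff_mul_eq']
    exact hc I J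

/-! ### The isomorphism -/

theorem weight_pow_eq_one {ψ : Arrow n r → ℂˣ} (hψ : ψ ∈ GTilde n r) (I : Index n r) :
    weight ψ I ^ n = 1 := by
  rw [weight, ← Finset.prod_pow]
  exact Finset.prod_eq_one fun a _ => hψ.1 a

/-- In the product over the `n` cyclic intervals the constant contributes `c ^ n = 1`, so `∏ ψ_a =
1` becomes exactly `(∏ ζ_i) ^ r = 1`. -/
theorem PreservesPlucker.exists_weight_eq (hr : 0 < r) (hrn : r < n) {ψ : Arrow n r → ℂˣ}
    (hψ : ψ ∈ GTilde n r) (h : PreservesPlucker ψ) :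
    ∃ ζ ∈ HTilde n r, ∃ c, ∀ I : Index n r, weight ψ I = c * ∏ i ∈ I.1, ζ i := by
  obtain ⟨c, ζ, hc, hζ, hw⟩ := exists_of_exchange hr hrn (weight_pow_eq_one hψ)
    (fun i j S T hij hiS hjS hiT hjT h1 h2 h3 h4 => h.exchange hij hiS hjS hiT hjT h1 h2 h3 h4)
  refine ⟨ζ, ⟨hζ, ?_⟩, c, hw⟩
  have h1 := hψ.2
  rw [prod_eq_prod_weight_cyclicIndex hr hrn] at h1
  simp_rw [hw] at h1
  rw [Finset.prod_mul_distrib, Finset.prod_const, Finset.card_univ, Fintype.card_fin, hc,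
    one_mul] at h1
  rw [← prod_prod_cyclicInterval hrn.le]
  exact h1

theorem psiTilde_mem_torus_iff (hr : 0 < r) (hrn : r < n) (ζ : Fin n → ℂˣ) :
    PsiTilde n r ζ ∈ Torus n r ↔ ∃ c, ∀ i, ζ i = c := by
  constructor
  · rintro ⟨τ, hτ, h⟩
    refine ⟨ζ ⟨0, by omega⟩, fun i => ?_⟩
    by_cases hi : i = ⟨0, by omega⟩
    · rw [hi]
    obtain ⟨S, hiS, hjS, h1, h2⟩ := exists_toIndex_insert hr hrn hi
    have e := (weight_torus hrn.le τ hτ h (toIndex _ h1)).trans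
      (weight_torus hrn.le τ hτ h (toIndex _ h2)).symm
    rw [weight_psiTilde hrn.le, weight_psiTilde hrn.le, toIndex, toIndex,
      Finset.prod_insert hiS, Finset.prod_insert hjS] at e
    exact mul_right_cancel e
  · rintro ⟨c, hc⟩
    refine mem_torus_of_weight_const hr hrn (c := c ^ r) fun I => ?_
    rw [weight_psiTilde hrn.le, Finset.prod_congr rfl fun i _ => hc i, Finset.prod_const, I.2]

/-- `Ψ̃` as a homomorphism to `G_h`. -/
def psiHom (hr : 0 < r) (hrn : r < n) : HTilde n r →* Gh n r where
  toFun ζ := ⟨QuotientGroup.mk ⟨PsiTilde n r ζ.1, psiTilde_mem_gTilde hr hrn ζ.2⟩, _,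
    preservesPlucker_of_weight ζ.1 (weight_psiTilde hrn.le ζ.1), rfl⟩
  map_one' := by
    refine Subtype.ext (congrArg QuotientGroup.mk (Subtype.ext (funext fun a => ?_)))
    exact Finset.prod_const_one
  map_mul' ζ ξ := by
    refine Subtype.ext (congrArg QuotientGroup.mk (Subtype.ext (funext fun a => ?_)))
    exact Finset.prod_mul_distrib

theorem psiHom_ker (hr : 0 < r) (hrn : r < n) : (psiHom hr hrn).ker = HScalar n r := by
  ext ζ
  rw [MonoidHom.mem_ker, ← Subtype.coe_inj]
  change (QuotientGroup.mk _ : G n r) = 1 ↔ _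
  rw [QuotientGroup.eq_one_iff, Subgroup.mem_subgroupOf]
  exact psiTilde_mem_torus_iff hr hrn ζ.1

/-- Dividing `ψ` by `Ψ̃(ζ)` leaves the constant weight `c`, hence an element of the torus. -/
theorem psiHom_surjective (hr : 0 < r) (hrn : r < n) : Function.Surjective (psiHom hr hrn) := by
  rintro ⟨_, ψ, hψ, rfl⟩
  obtain ⟨ζ, hζ, c, hc⟩ := hψ.exists_weight_eq hr hrn ψ.2
  refine ⟨⟨ζ, hζ⟩, Subtype.ext ?_⟩
  refine QuotientGroup.eq.2 (Subgroup.mem_subgroupOf.2 ?_)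
  refine mem_torus_of_weight_const hr hrn (c := c) fun I => ?_
  change weight ((PsiTilde n r ζ)⁻¹ * ψ.1) I = c
  rw [weight_mul, weight_inv, weight_psiTilde hrn.le, hc, mul_comm c, inv_mul_cancel_left]

end Ladder

end

theorem mainTheorem4 (n r : ℕ) (hr : 0 < r) (hrn : r < n) :
    (∀ ψ ∈ Ladder.Torus n r ⊓ Ladder.GTilde n r,
      ∃ c : ℂˣ, ∀ I : Ladder.Index n r, Ladder.weight ψ I = c) ∧
    (∀ ζ : Ladder.HTilde n r, ζ ∈ Ladder.HScalar n r ↔ Ladder.ActsTriviallyOnGr n r ζ.1) ∧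
    ∃ hΨ : ∀ ζ ∈ Ladder.HTilde n r, Ladder.PsiTilde n r ζ ∈ Ladder.GTilde n r,
      ∃ e : Ladder.H n r ≃* Ladder.Gh n r, ∀ ζ : Ladder.HTilde n r,
        ((e (QuotientGroup.mk ζ) : Ladder.Gh n r) : Ladder.G n r) =
          QuotientGroup.mk ⟨Ladder.PsiTilde n r ζ.1, hΨ ζ.1 ζ.2⟩ := by
  refine ⟨?_, Ladder.mem_hScalar_iff hr hrn,
    fun _ hζ => Ladder.psiTilde_mem_gTilde hr hrn hζ,
    (QuotientGroup.quotientMulEquivOfEq (Ladder.psiHom_ker hr hrn).symm).trans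
      (QuotientGroup.quotientKerEquivOfSurjective _ (Ladder.psiHom_surjective hr hrn)),
    fun ζ => rfl⟩
  rintro ψ ⟨⟨τ, hτ, h⟩, -⟩
  exact ⟨_, Ladder.weight_torus hrn.le τ hτ h⟩
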